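/- Let $G$ be a countably infinite discrete group with identity $e_G$, let $\mu$ be a probability measure on $G$ and let $\alpha\in[0,1)$. On a probability space let $(\xi_n)_{n\ge2}$ be i.i.d. Bernoulli variables with success parameter $\alpha$, let $(u_n)_{n\ge2}$ be independent variables, independent of $(\xi_n)_{n\ge 2}$, with $u_n$ uniform on $\{1,\dots,n-1\}$, let $(T_n)_{n\ge2}$ be random maps $G\to G$ such that, for each $n$, $T_n$ is independent of $(\xi_k,u_k)_{k\ge n}$, and let $(g_n)_{n\ge1}$ be i.i.d. with law $\mu$ and independent of $(\xi_n,u_n,T_n)_{n\ge2}$. Set $S_0=e_G$, $X_1=g_1$ and, for $n\ge2$, $X_n=T_n(X_{u_n})$ if $\xi_n=1$ and $X_n=g_n$ if $\xi_n=0$; put $S_n=S_{n-1}\cdot X_n$ for $n\ge1$. The process $S=(S_n)_{n\ge0}$ is a generalized step-reinforced random walk (SRRW) on $G$ with parameter $\alpha$, step distribution $\mu$ and transformations $(T_n)_{n\ge2}$. Let $P_\mu(x,y)=\mu(x^{-1}y)$ and $P_\mu(A,B)=\sum_{x\in A,\,y\in B}P_\mu(x,y)$. The walk is called irreducible if the transition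 matrix $P_\mu$ is irreducible. For $r\ge1$ let $$\Phi(r)=\inf\left\{\frac{P_\mu(A,A^c)}{|A|}:\ \emptyset\ne A\subset G,\ |A|\le r\right\}.$$ **Theorem (lazy chains).** For every $\mu_0\in(0,1/2]$ there is a constant $C(\mu_0)>0$, depending only on $\mu_0$, such that the following holds. Let $S$ be an irreducible generalized SRRW, as above, on a countably infinite group $G$ with parameter $\alpha\in[0,1)$ and step distribution $\mu$ satisfying $\mu(e_G)\ge\mu_0$. Then for every $\varepsilon\in(0,1)$ and every integer $n\ge0$, $$\max_{x\in G}\mathbb P(S_n=x)\le\varepsilon\qquad\text{if}\qquad n\ \ge\ \frac{C(\mu_0)}{1-\alpha}\int_4^{8/\varepsilon}\frac{du}{u\,\Phi^2(u)}.$$ -/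

import Mathlib

open MeasureTheory ProbabilityTheory
open scoped ENNReal

universe v w

/-- `S` is a generalized step-reinforced random walk on the (discrete) group `G`, started at the
identity, with reinforcement parameter `α`, step distribution `μ` and random transformations
`T n` (`n ≥ 2`), built on the probability space `(Ω, P)` from

* `ξ n` (`n ≥ 2`): the i.i.d. Bernoulli(`α`) variables telling whether step `n` is reinforced,
* `u n` (`n ≥ 2`): the independent uniform variables on `{1, …, n - 1}` choosing a past step,
* `g n` (`n ≥ 1`): the i.i.d. `μ`-distributed samples providing the fresh steps.

`X n` (`n ≥ 1`) is the step sequence. Values of the sequences at smaller indices play no role.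
A random transformation is a random element of `G → G` (with the product σ-algebra), and the
fresh samples are drawn independently of `(ξ, u, T)`. -/
structure IsGeneralizedSRRW {G Ω : Type*} [Group G] [MeasurableSpace G] [MeasurableSpace Ω]
    (P : Measure Ω) (α : ℝ) (μ : Measure G) (ξ : ℕ → Ω → Bool) (u : ℕ → Ω → ℕ)
    (T : ℕ → Ω → G → G) (g : ℕ → Ω → G) (X S : ℕ → Ω → G) : Prop where
  measurable_ξ : ∀ n, 2 ≤ n → Measurable (ξ n)
  measurable_u : ∀ n, 2 ≤ n → Measurable (u n)
  measurable_T : ∀ n, 2 ≤ n → Measurable (T n)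
  measurable_g : ∀ n, 1 ≤ n → Measurable (g n)
  /-- `ξ n` is Bernoulli with success parameter `α`. -/
  law_ξ : ∀ n, 2 ≤ n → P.real {ω | ξ n ω = true} = α
  /-- `u n` is uniform on `{1, …, n - 1}`. -/
  law_u : ∀ n, 2 ≤ n → ∀ i, 1 ≤ i → i < n → P.real {ω | u n ω = i} = 1 / ((n : ℝ) - 1)
  /-- `g n` has law `μ`. -/
  law_g : ∀ n, 1 ≤ n → P.map (g n) = μ
  indep_ξ : iIndepFun (fun (n : Set.Ici 2) ω => ξ n ω) P
  indep_u : iIndepFun (fun (n : Set.Ici 2) ω => u n ω) P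
  indep_g : iIndepFun (fun (n : Set.Ici 1) ω => g n ω) P
  /-- The families `ξ` and `u` are independent of each other. -/
  indep_ξ_u : IndepFun (fun ω (n : Set.Ici 2) => ξ n ω) (fun ω (n : Set.Ici 2) => u n ω) P
  /-- `T n` is independent of the present and future `(ξ k, u k)`, `k ≥ n`. -/
  indep_T : ∀ n, 2 ≤ n → IndepFun (T n) (fun ω (k : Set.Ici n) => (ξ k ω, u k ω)) P
  /-- The fresh samples are independent of `(ξ, u, T)`. -/
  indep_fresh : IndepFun (fun ω (n : Set.Ici 1) => g n ω)
    (fun ω (n : Set.Ici 2) => (ξ n ω, u n ω, T n ω)) P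
  step_one : ∀ ω, X 1 ω = g 1 ω
  step : ∀ n, 2 ≤ n → ∀ ω, X n ω = if ξ n ω = true then T n ω (X (u n ω) ω) else g n ω
  walk_zero : ∀ ω, S 0 ω = 1
  walk_succ : ∀ n ω, S (n + 1) ω = S n ω * X (n + 1) ω

section Profile

variable {G : Type*} [Group G] [MeasurableSpace G]

/-- The transition probabilities `P_μ(x, y) = μ(x⁻¹ y)`. -/
def stepKernel (μ : Measure G) (x y : G) : ℝ≥0∞ := μ {x⁻¹ * y}

open Classical in
/-- The `n`-step transition probabilities of `P_μ`. -/
noncomputable def stepKernelPow (μ : Measure G) : ℕ → G → G → ℝ≥0∞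
  | 0, x, y => if x = y then 1 else 0
  | n + 1, x, y => ∑' z, stepKernel μ x z * stepKernelPow μ n z y

/-- `P_μ` is irreducible: every state can be reached from every state. -/
def IsIrreducibleStep (μ : Measure G) : Prop :=
  ∀ x y : G, ∃ n : ℕ, 0 < stepKernelPow μ n x y

/-- `P_μ(A, B)`, the sum of `P_μ(x, y)` over `x ∈ A` and `y ∈ B`. -/
noncomputable def stepFlow (μ : Measure G) (A B : Set G) : ℝ≥0∞ :=
  ∑' (x : A) (y : B), stepKernel μ x y

/-- The bottleneck ratio `P_μ(A, Aᶜ) / |A|` of a finite set `A`. For a probability measure `μ`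
the flow is at most `|A|`, hence finite. -/
noncomputable def bottleneckRatio (μ : Measure G) (A : Finset G) : ℝ :=
  (stepFlow μ (A : Set G) (A : Set G)ᶜ).toReal / (A.card : ℝ)

/-- The isoperimetric profile: the infimum of the bottleneck ratios of the non-empty finite sets
with at most `r` elements (used for `r ≥ 1`). -/
noncomputable def isoperimetricProfile (μ : Measure G) (r : ℝ) : ℝ :=
  sInf {φ : ℝ | ∃ A : Finset G, A.Nonempty ∧ (A.card : ℝ) ≤ r ∧ φ = bottleneckRatio μ A}

end Profile

/-!
The return probability is bounded in `ℓ²`. Write `collision ν = ∑ x, ν {x} ^ 2`.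

* Analytic part. If a letter of law `μ` with `μ {1} ≥ γ` is appended to an independent word of law
  `ν` with collision probability `t`, laziness turns the decrease of the collision probability into
  a Dirichlet energy (`collision_mconv_add_le`). Cutting `ν` at the level `t / 4` leaves a function
  supported on at most `4 / t` points that keeps half of the `ℓ²` mass, so Cheeger's inequality on
  small sets (`cheeger_inequality`) bounds the energy below by the profile at `4 / t`. Hence `t` is
  multiplied by at most `1 - γ / 32 * Φ (4 / t) ^ 2` (`collision_mconv_le`). Multiplication by a
  constant preserves `t`. In terms of the potential `∫ r in 4..4 / t, 1 / (r * Φ r ^ 2)`, every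
  `μ`-letter contributes at least `γ / 32` (`integral_profile_mconv`). A word made of two
  independent pieces, each with collision probability at most `η`, hits any given point with
  probability at most `η` (`mconv_real_singleton_le`); together this gives
  `measureReal_wordProd_le`. Irreducibility and infiniteness of the group make the profile positive
  (`isoperimetricProfile_pos`), so that the integrals are genuine.

* Probabilistic part. A fresh step that is never copied before time `n` occurs exactly once in the
  word `S n`. Freezing `(ξ, u, T)` and all other fresh samples, `S n` becomes a word in independent
  letters, each of law `μ` or constant, and the analytic bound applies
  (`measure_wordProd_stepValue_le`). An exponential moment bound for the last fifth of the steps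
  shows that there are of order `(1 - α) * n` such letters outside an event of exponentially
  small probability (`measureReal_freshSet_lt_le`). Since `Φ ≤ 1`, the integral in the theorem is at
  least `log (2 / ε)`, which makes that exceptional probability at most `ε / 2`.
-/

/-! ### Coarea and Cheeger inequalities on a group -/

section Energy

variable {G : Type*} [Group G] [MeasurableSpace G] [DiscreteMeasurableSpace G]

lemma stepFlow_compl_eq_sum [Countable G] (μ : Measure G) (A : Finset G) :
    stepFlow μ (A : Set G) (A : Set G)ᶜ = ∑ x ∈ A, μ {g | x * g ∉ A} := by
  have h (x : G) : ∑' y : ((A : Set G)ᶜ : Set G), stepKernel μ x y = μ {g | x * g ∉ A} := by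
    have := tsum_measure_preimage_singleton (μ := μ) (s := ((A : Set G)ᶜ : Set G))
      (Set.to_countable _) (f := fun g => x * g) (fun y _ => MeasurableSet.of_discrete)
    have e : (fun g => x * g) ⁻¹' ((A : Set G)ᶜ) = {g | x * g ∉ A} := by ext; simp
    rw [e] at this
    rw [← this]
    refine tsum_congr fun y => ?_
    rw [stepKernel]
    congr 1
    ext g
    simp [eq_inv_mul_iff_mul_eq]
  rw [stepFlow]
  simp_rw [h]
  exact Finset.tsum_subtype A (fun x => μ {g | x * g ∉ A})

omit [Group G] in
lemma integrable_of_abs_le {μ : Measure G} [IsProbabilityMeasure μ] (a : G → ℝ) (M : ℝ)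
    (h : ∀ g, |a g| ≤ M) : Integrable a μ :=
  Integrable.of_bound (Measurable.of_discrete.aestronglyMeasurable) M (.of_forall h)

/-- Coarea inequality: a lower bound `φ` on the boundary flow of all subsets of `A` passes to
nonnegative functions supported on `A`. The induction removes the lowest level of `F`, which is
`F a` times the indicator of `A`. -/
lemma le_sum_integral_posPart (μ : Measure G) [IsProbabilityMeasure μ] (φ M : ℝ) (A : Finset G) :
    ∀ F : G → ℝ, (∀ x, 0 ≤ F x) → (∀ x, F x ≤ M) → (∀ x, x ∉ A → F x = 0) →
    (∀ B ⊆ A, φ * B.card ≤ ∑ x ∈ B, μ.real {g | x * g ∉ B}) →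
    φ * ∑ x ∈ A, F x ≤ ∑ x ∈ A, ∫ g, max (F x - F (x * g)) 0 ∂μ := by
  classical
  induction A using Finset.strongInduction with
  | H A ih =>
  intro F hF0 hFM hFA hφ
  rcases A.eq_empty_or_nonempty with rfl | hA
  · simp
  obtain ⟨a, ha, hmin⟩ := A.exists_min_image F hA
  set F' : G → ℝ := fun x => if x ∈ A then F x - F a else 0 with hF'
  have h0 (x) : 0 ≤ F' x := by
    simp only [hF']; split_ifs with h
    · exact sub_nonneg.2 (hmin x h)
    · exact le_rfl
  have hM (x) : F' x ≤ M := by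
    simp only [hF']; split_ifs with h
    · linarith [hF0 a, hFM x]
    · exact (hF0 a).trans (hFM a)
  have key := ih (A.erase a) (Finset.erase_ssubset ha) F' h0 hM (by
      intro x hx
      by_cases hxA : x ∈ A
      · have : x = a := by by_contra h; exact hx (Finset.mem_erase.2 ⟨h, hxA⟩)
        simp [hF', this]
      · simp [hF', hxA])
    (fun B hB => hφ B (hB.trans (Finset.erase_subset _ _)))
  have hint (H : G → ℝ) (h0 : ∀ x, 0 ≤ H x) (hM : ∀ x, H x ≤ M) (x : G) :
      Integrable (fun g => max (H x - H (x * g)) 0) μ :=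
    integrable_of_abs_le _ M fun g => by
      rw [abs_of_nonneg (le_max_right _ _)]
      exact max_le (by linarith [hM x, h0 (x * g)]) ((h0 x).trans (hM x))
  have split (x) (hx : x ∈ A) : ∫ g, max (F x - F (x * g)) 0 ∂μ =
      F a * μ.real {g | x * g ∉ A} + ∫ g, max (F' x - F' (x * g)) 0 ∂μ := by
    have e : ∀ g, max (F x - F (x * g)) 0 =
        Set.indicator {g | x * g ∉ A} (fun _ => F a) g + max (F' x - F' (x * g)) 0 := by
      intro g
      by_cases hg : x * g ∈ A
      · simp [hF', hx, hg]
      · have := hmin x hx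
        simp only [hF', hx, hg, Set.indicator, Set.mem_ofPred_eq, not_false_eq_true, if_true,
          if_false, hFA _ hg, sub_zero]
        rw [max_eq_left (hF0 x), max_eq_left (by linarith)]
        ring
    simp_rw [e]
    rw [integral_add _ (hint F' h0 hM x), integral_indicator_const _ MeasurableSet.of_discrete,
      smul_eq_mul, mul_comm]
    exact (integrable_const _).indicator MeasurableSet.of_discrete
  rw [Finset.sum_congr rfl split, Finset.sum_add_distrib, ← Finset.mul_sum]
  have hsum : ∑ x ∈ A, F x = F a * A.card + ∑ x ∈ A.erase a, F' x := by
    have : F' a = 0 := by simp [hF']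
    rw [Finset.sum_erase _ this]
    have : ∀ x ∈ A, F x = F a + F' x := fun x hx => by simp [hF', hx]
    rw [Finset.sum_congr rfl this, Finset.sum_add_distrib]
    simp [mul_comm]
  have h2 : ∑ x ∈ A.erase a, ∫ g, max (F' x - F' (x * g)) 0 ∂μ ≤
      ∑ x ∈ A, ∫ g, max (F' x - F' (x * g)) 0 ∂μ :=
    Finset.sum_le_sum_of_subset_of_nonneg (Finset.erase_subset _ _)
      fun x _ _ => integral_nonneg fun g => le_max_right _ _
  have h3 := mul_le_mul_of_nonneg_left (hφ A subset_rfl) (hF0 a)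
  rw [hsum, mul_add]
  linarith

/-- Cheeger's inequality with Dirichlet boundary condition on `A`: the coarea inequality for
`f ^ 2`, followed by Young's inequality for `f x ^ 2 - f y ^ 2 = (f x - f y) * (f x + f y)`. -/
lemma cheeger_inequality (μ : Measure G) [IsProbabilityMeasure μ] (φ M : ℝ) (hφ0 : 0 < φ) (A : Finset G)
    (f : G → ℝ) (hf0 : ∀ x, 0 ≤ f x) (hfM : ∀ x, f x ≤ M) (hfA : ∀ x, x ∉ A → f x = 0)
    (hφ : ∀ B ⊆ A, φ * B.card ≤ ∑ x ∈ B, μ.real {g | x * g ∉ B}) :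
    φ ^ 2 / 4 * ∑ x ∈ A, f x ^ 2 ≤ ∑ x ∈ A, ∫ g, (f x - f (x * g)) ^ 2 ∂μ := by
  classical
  have h1 := le_sum_integral_posPart μ φ (M ^ 2) A (fun x => f x ^ 2) (fun x => sq_nonneg _)
    (fun x => pow_le_pow_left₀ (hf0 x) (hfM x) 2) (fun x hx => by simp [hfA x hx]) hφ
  have hM0 : 0 ≤ M := (hf0 1).trans (hfM 1)
  have i1 (x) : Integrable (fun g => (f x - f (x * g)) ^ 2) μ :=
    integrable_of_abs_le _ (M ^ 2) fun g => by
      rw [abs_of_nonneg (sq_nonneg _), sq_le_sq, abs_of_nonneg hM0, abs_le]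
      constructor <;> linarith [hf0 x, hf0 (x * g), hfM x, hfM (x * g)]
  have i2 (x) : Integrable (fun g => f (x * g) ^ 2) μ :=
    integrable_of_abs_le _ (M ^ 2) fun g => by
      rw [abs_of_nonneg (sq_nonneg _), sq_le_sq, abs_of_nonneg hM0, abs_le]
      constructor <;> linarith [hf0 (x * g), hfM (x * g)]
  have i3 (x) : Integrable (fun g => max (f x ^ 2 - f (x * g) ^ 2) 0) μ :=
    integrable_of_abs_le _ (M ^ 2) fun g => by
      rw [abs_of_nonneg (le_max_right _ _)]
      refine max_le ?_ (sq_nonneg _)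
      have := pow_le_pow_left₀ (hf0 x) (hfM x) 2
      linarith [sq_nonneg (f (x * g))]
  have h2 (x) : ∫ g, max (f x ^ 2 - f (x * g) ^ 2) 0 ∂μ ≤
      2 / φ * ∫ g, (f x - f (x * g)) ^ 2 ∂μ + φ / 4 * (f x ^ 2 + ∫ g, f (x * g) ^ 2 ∂μ) := by
    have i4 : Integrable (fun g => f x ^ 2 + f (x * g) ^ 2) μ := (integrable_const _).add (i2 x)
    have e : 2 / φ * ∫ g, (f x - f (x * g)) ^ 2 ∂μ + φ / 4 * (f x ^ 2 + ∫ g, f (x * g) ^ 2 ∂μ) =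
        ∫ g, (2 / φ * (f x - f (x * g)) ^ 2 + φ / 4 * (f x ^ 2 + f (x * g) ^ 2)) ∂μ := by
      rw [integral_add ((i1 x).const_mul _) (i4.const_mul _), integral_const_mul,
        integral_const_mul, integral_add (integrable_const _) (i2 x)]
      simp
    rw [e]
    refine integral_mono (i3 x) (((i1 x).const_mul _).add (i4.const_mul _)) fun g => ?_
    simp only
    set a := f x
    set b := f (x * g)
    refine max_le ?_ (by positivity)
    have e : 2 / φ * (a - b) ^ 2 + φ / 4 * (a ^ 2 + b ^ 2) - (a ^ 2 - b ^ 2) =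
        2 / φ * ((a - b) - φ / 4 * (a + b)) ^ 2 + φ / 8 * (a - b) ^ 2 := by
      field_simp; ring
    have : 0 ≤ 2 / φ * ((a - b) - φ / 4 * (a + b)) ^ 2 + φ / 8 * (a - b) ^ 2 := by positivity
    linarith
  have h3 : ∑ x ∈ A, ∫ g, f (x * g) ^ 2 ∂μ ≤ ∑ x ∈ A, f x ^ 2 := by
    rw [← integral_finsetSum _ fun x _ => i2 x]
    have : ∑ x ∈ A, f x ^ 2 = ∫ _, ∑ x ∈ A, f x ^ 2 ∂μ := by simp
    rw [this]
    refine integral_mono (integrable_finsetSum _ fun x _ => i2 x) (integrable_const _) fun g => ?_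
    have e : ∑ x ∈ A, f (x * g) ^ 2 = ∑ y ∈ A.map (mulRightEmbedding g), f y ^ 2 := by
      rw [Finset.sum_map]; rfl
    simp only [e]
    rw [← Finset.sum_inter_add_sum_sdiff _ A]
    have z : ∑ y ∈ A.map (mulRightEmbedding g) \ A, f y ^ 2 = 0 :=
      Finset.sum_eq_zero fun y hy => by simp [hfA y (Finset.mem_sdiff.1 hy).2]
    rw [z, add_zero]
    exact Finset.sum_le_sum_of_subset_of_nonneg Finset.inter_subset_right
      fun _ _ _ => sq_nonneg _
  have h4 := h1.trans (Finset.sum_le_sum fun x _ => h2 x)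
  rw [Finset.sum_add_distrib, ← Finset.mul_sum, ← Finset.mul_sum, Finset.sum_add_distrib] at h4
  set E := ∑ x ∈ A, ∫ g, (f x - f (x * g)) ^ 2 ∂μ
  set N := ∑ x ∈ A, f x ^ 2
  have h5 : φ / 2 * N ≤ 2 / φ * E := by
    have := mul_le_mul_of_nonneg_left h3 (by positivity : 0 ≤ φ / 4)
    linarith
  have h6 := mul_le_mul_of_nonneg_left h5 (by positivity : 0 ≤ φ / 2)
  have e : φ / 2 * (2 / φ * E) = E := by field_simp
  rw [e] at h6
  linarith

/-- An atom of mass at least `γ` at the identity makes the variance of `a` comparable to its mean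
square deviation from the value at the atom. -/
lemma sq_integral_add_le (μ : Measure G) [IsProbabilityMeasure μ] (γ M : ℝ) (hγ0 : 0 ≤ γ)
    (hγ : γ ≤ μ.real {1}) (a : G → ℝ) (ha : ∀ g, |a g| ≤ M) :
    (∫ g, a g ∂μ) ^ 2 + γ / 4 * ∫ g, (a g - a 1) ^ 2 ∂μ ≤ ∫ g, a g ^ 2 ∂μ := by
  have ib (b : G → ℝ) (K : ℝ) (hb : ∀ g, |b g| ≤ K) : Integrable (fun g => b g ^ 2) μ :=
    integrable_of_abs_le _ (K ^ 2) fun g => by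
      rw [abs_pow]; exact pow_le_pow_left₀ (abs_nonneg _) (hb g) 2
  have ia := integrable_of_abs_le (μ := μ) a M ha
  set m := ∫ g, a g ∂μ
  have iv : Integrable (fun g => (a g - m) ^ 2) μ := ib _ (M + |m|) fun g =>
    (abs_sub _ _).trans (by linarith [ha g])
  have i1 : Integrable (fun g => (a g - a 1) ^ 2) μ := ib _ (M + M) fun g =>
    (abs_sub _ _).trans (by linarith [ha g, ha 1])
  have hv : ∫ g, (a g - m) ^ 2 ∂μ = ∫ g, a g ^ 2 ∂μ - m ^ 2 := by
    have e : ∀ g, (a g - m) ^ 2 = a g ^ 2 - (2 * m * a g - m ^ 2) := fun g => by ring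
    simp_rw [e]
    have i2 : Integrable (fun g => 2 * m * a g - m ^ 2) μ :=
      (ia.const_mul _).sub (integrable_const _)
    rw [integral_sub (ib a M ha) i2,
      integral_sub (ia.const_mul _) (integrable_const _), integral_const_mul]
    simp only [integral_const, probReal_univ, smul_eq_mul]
    change _ - (2 * m * m - 1 * m ^ 2) = _
    ring
  have hv1 : γ * (a 1 - m) ^ 2 ≤ ∫ g, (a g - m) ^ 2 ∂μ := by
    have : ∫ g, Set.indicator {1} (fun _ => (a 1 - m) ^ 2) g ∂μ ≤ ∫ g, (a g - m) ^ 2 ∂μ := by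
      refine integral_mono ((integrable_const _).indicator MeasurableSet.of_discrete) iv fun g => ?_
      by_cases hg : g = 1
      · simp [hg]
      · simp [hg, sq_nonneg]
    rw [integral_indicator_const _ MeasurableSet.of_discrete, smul_eq_mul] at this
    exact (mul_le_mul_of_nonneg_right hγ (sq_nonneg _)).trans this
  have h2 : ∫ g, (a g - a 1) ^ 2 ∂μ ≤ 2 * ∫ g, (a g - m) ^ 2 ∂μ + 2 * (a 1 - m) ^ 2 := by
    have : 2 * (a 1 - m) ^ 2 = ∫ _, 2 * (a 1 - m) ^ 2 ∂μ := by simp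
    rw [this, ← integral_const_mul, ← integral_add (iv.const_mul _) (integrable_const _)]
    refine integral_mono i1 ((iv.const_mul _).add (integrable_const _)) fun g => ?_
    nlinarith [sq_nonneg ((a g - m) + (a 1 - m))]
  have hγ1 : γ ≤ 1 := hγ.trans measureReal_le_one
  have hV0 : 0 ≤ ∫ g, (a g - m) ^ 2 ∂μ := integral_nonneg fun g => sq_nonneg _
  set V := ∫ g, (a g - m) ^ 2 ∂μ
  have h3 := mul_le_mul_of_nonneg_left h2 (by positivity : 0 ≤ γ / 4)
  have h4 := mul_le_mul_of_nonneg_right hγ1 hV0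
  linarith

end Energy

/-! ### Decay of the collision probability -/

section Collision

variable {G : Type*} [Group G] [Countable G] [MeasurableSpace G] [DiscreteMeasurableSpace G]

/-- The probability `∑ x, ν {x} ^ 2` that two independent samples of `ν` agree, i.e. the squared
`ℓ²` norm of the weights. The sum converges when `ν` is a probability measure. -/
noncomputable def collision (ν : Measure G) : ℝ := ∑' x, ν.real {x} ^ 2

omit [Group G] in
lemma hasSum_measureReal_singleton (ν : Measure G) [IsProbabilityMeasure ν] :
    HasSum (fun x => ν.real {x}) 1 := by
  have h : ∑' x, ν {x} = 1 := by
    have := tsum_measure_preimage_singleton (μ := ν) (s := Set.univ) Set.countable_univ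
      (f := id) (fun y _ => MeasurableSet.of_discrete)
    simpa [tsum_univ (fun x => ν {x})] using this
  have h2 := ENNReal.hasSum_toReal (f := fun x => ν {x}) (by rw [h]; simp)
  rwa [← ENNReal.tsum_toReal_eq (fun x => measure_ne_top _ _), h, ENNReal.toReal_one] at h2

omit [Group G] in
lemma summable_measureReal_singleton_sq (ν : Measure G) [IsProbabilityMeasure ν] :
    Summable (fun x => ν.real {x} ^ 2) :=
  (hasSum_measureReal_singleton ν).summable.of_nonneg_of_le (fun _ => sq_nonneg _) fun x => by
    rw [sq]; exact mul_le_of_le_one_left measureReal_nonneg measureReal_le_one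

omit [Group G] in
lemma collision_pos (ν : Measure G) [IsProbabilityMeasure ν] : 0 < collision ν := by
  have h1 := hasSum_measureReal_singleton ν
  obtain ⟨x, hx⟩ : ∃ x, 0 < ν.real {x} := by
    by_contra! h
    have : (fun x => ν.real {x}) = 0 := funext fun x => le_antisymm (h x) measureReal_nonneg
    rw [this] at h1
    exact zero_ne_one (hasSum_zero.unique h1)
  exact (summable_measureReal_singleton_sq ν).tsum_pos (fun _ => sq_nonneg _) x (by positivity)

omit [Group G] in
lemma collision_le_one (ν : Measure G) [IsProbabilityMeasure ν] : collision ν ≤ 1 := by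
  have h1 := hasSum_measureReal_singleton ν
  rw [← h1.tsum_eq]
  refine (summable_measureReal_singleton_sq ν).tsum_le_tsum (fun x => ?_) h1.summable
  rw [sq]; exact mul_le_of_le_one_left measureReal_nonneg measureReal_le_one

omit [Group G] in
lemma ofReal_collision (ν : Measure G) [IsProbabilityMeasure ν] :
    ENNReal.ofReal (collision ν) = ∑' x, ENNReal.ofReal (ν.real {x} ^ 2) :=
  ENNReal.ofReal_tsum_of_nonneg (fun _ => sq_nonneg _) (summable_measureReal_singleton_sq ν)

lemma mconv_singleton (ν μ : Measure G) [IsProbabilityMeasure ν] [IsProbabilityMeasure μ] (x : G) :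
    (ν ∗ₘ μ) {x} = ∫⁻ g, ν {x * g⁻¹} ∂μ := by
  rw [Measure.mconv, Measure.map_apply Measurable.of_discrete MeasurableSet.of_discrete,
    Measure.prod_apply_symm MeasurableSet.of_discrete]
  refine lintegral_congr fun g => congrArg ν ?_
  ext y; simp [eq_mul_inv_iff_mul_eq]

lemma mconv_real_singleton (ν μ : Measure G) [IsProbabilityMeasure ν] [IsProbabilityMeasure μ]
    (x : G) : (ν ∗ₘ μ).real {x} = ∫ g, ν.real {x * g⁻¹} ∂μ := by
  rw [Measure.real, mconv_singleton]
  exact (integral_toReal Measurable.of_discrete.aemeasurable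
    (.of_forall fun g => measure_lt_top _ _)).symm

lemma collision_mconv_dirac (ν : Measure G) [IsProbabilityMeasure ν] (h : G) :
    collision (ν ∗ₘ Measure.dirac h) = collision ν := by
  simp only [collision, mconv_real_singleton, integral_dirac]
  exact (Equiv.mulRight h⁻¹).tsum_eq (fun x => ν.real {x} ^ 2)

/-- Young's inequality `ab ≤ (a ^ 2 + b ^ 2) / 2` under the convolution sum. -/
lemma mconv_real_singleton_le (ν₁ ν₂ : Measure G) [IsProbabilityMeasure ν₁]
    [IsProbabilityMeasure ν₂] (x : G) :
    (ν₁ ∗ₘ ν₂).real {x} ≤ (collision ν₁ + collision ν₂) / 2 := by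
  have h : (ν₁ ∗ₘ ν₂) {x} ≤ ENNReal.ofReal ((collision ν₁ + collision ν₂) / 2) := by
    rw [mconv_singleton, lintegral_countable']
    have e : ∑' y, ENNReal.ofReal (ν₁.real {x * y⁻¹} ^ 2) = ENNReal.ofReal (collision ν₁) := by
      rw [ofReal_collision]
      exact ((Equiv.inv G).trans (Equiv.mulLeft x)).tsum_eq
        (fun y => ENNReal.ofReal (ν₁.real {y} ^ 2))
    calc ∑' y, ν₁ {x * y⁻¹} * ν₂ {y}
        ≤ ∑' y, ENNReal.ofReal (1 / 2) * (ENNReal.ofReal (ν₁.real {x * y⁻¹} ^ 2) +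
            ENNReal.ofReal (ν₂.real {y} ^ 2)) := by
          refine ENNReal.tsum_le_tsum fun y => ?_
          rw [← ofReal_measureReal (μ := ν₁) (measure_ne_top _ _),
            ← ofReal_measureReal (μ := ν₂) (measure_ne_top _ _),
            ← ENNReal.ofReal_mul measureReal_nonneg,
            ← ENNReal.ofReal_add (sq_nonneg _) (sq_nonneg _), ← ENNReal.ofReal_mul (by norm_num)]
          refine ENNReal.ofReal_le_ofReal ?_
          nlinarith [sq_nonneg (ν₁.real {x * y⁻¹} - ν₂.real {y})]
      _ = _ := by
          rw [ENNReal.tsum_mul_left, ENNReal.tsum_add, e, ← ofReal_collision,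
            ← ENNReal.ofReal_add (collision_pos _).le (collision_pos _).le,
            ← ENNReal.ofReal_mul (by norm_num)]
          congr 1; ring
  refine ENNReal.toReal_le_of_le_ofReal ?_ h
  have := collision_pos ν₁
  have := collision_pos ν₂
  positivity

/-- A lazy step lowers the collision probability by a multiple of the Dirichlet energy, here
restricted to the starting points in a finite set `A`. -/
lemma collision_mconv_add_le (ν μ : Measure G) [IsProbabilityMeasure ν] [IsProbabilityMeasure μ]
    (γ : ℝ) (hγ0 : 0 ≤ γ) (hγ : γ ≤ μ.real {1}) (A : Finset G) :
    collision (ν ∗ₘ μ) + γ / 4 * ∑ x ∈ A, ∫ g, (ν.real {x} - ν.real {x * g}) ^ 2 ∂μ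
      ≤ collision ν := by
  have hb (x) : |ν.real {x}| ≤ 1 := by
    rw [abs_of_nonneg measureReal_nonneg]; exact measureReal_le_one
  have hb2 (x y) : |(ν.real {x} - ν.real {y}) ^ 2| ≤ 1 := by
    rw [abs_of_nonneg (sq_nonneg _), sq_le_one_iff_abs_le_one, abs_le]
    have h1 : 0 ≤ ν.real {x} := measureReal_nonneg
    have h2 : ν.real {x} ≤ 1 := measureReal_le_one
    have h3 : 0 ≤ ν.real {y} := measureReal_nonneg
    have h4 : ν.real {y} ≤ 1 := measureReal_le_one
    constructor <;> linarith
  have hb3 (x) : |(ν.real {x}) ^ 2| ≤ 1 := by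
    rw [abs_of_nonneg (sq_nonneg _), sq_le_one_iff_abs_le_one]; exact hb x
  set p : G → ℝ := fun x => ν.real {x} with hp
  -- Sums and integrals are exchanged in `ℝ≥0∞`, where no summability has to be checked.
  have key (x) : ENNReal.ofReal ((ν ∗ₘ μ).real {x} ^ 2) +
      ENNReal.ofReal (γ / 4) * ∫⁻ g, ENNReal.ofReal ((p (x * g⁻¹) - p x) ^ 2) ∂μ ≤
      ∫⁻ g, ENNReal.ofReal (p (x * g⁻¹) ^ 2) ∂μ := by
    have := sq_integral_add_le μ γ 1 hγ0 hγ (fun g => p (x * g⁻¹)) (fun g => hb _)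
    simp only [inv_one, mul_one] at this
    rw [← ofReal_integral_eq_lintegral_ofReal (integrable_of_abs_le _ 1 fun g => hb2 _ _)
        (.of_forall fun g => sq_nonneg _),
      ← ofReal_integral_eq_lintegral_ofReal (integrable_of_abs_le _ 1 fun g => hb3 _)
        (.of_forall fun g => sq_nonneg _), ← ENNReal.ofReal_mul (by positivity),
        mconv_real_singleton, ← ENNReal.ofReal_add (sq_nonneg _)
        (mul_nonneg (by positivity) (integral_nonneg fun g => sq_nonneg _))]
    exact ENNReal.ofReal_le_ofReal this
  have h1 := ENNReal.tsum_le_tsum key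
  rw [ENNReal.tsum_add, ENNReal.tsum_mul_left, ← ofReal_collision,
    ← lintegral_tsum (fun _ => Measurable.of_discrete.aemeasurable),
    ← lintegral_tsum (fun _ => Measurable.of_discrete.aemeasurable)] at h1
  have e1 (g : G) : ∑' x, ENNReal.ofReal (p (x * g⁻¹) ^ 2) = ENNReal.ofReal (collision ν) := by
    rw [ofReal_collision]
    exact (Equiv.mulRight g⁻¹).tsum_eq (fun x => ENNReal.ofReal (p x ^ 2))
  have e2 (g : G) : ∑' x, ENNReal.ofReal ((p (x * g⁻¹) - p x) ^ 2) =
      ∑' x, ENNReal.ofReal ((p x - p (x * g)) ^ 2) := by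
    have := (Equiv.mulRight g⁻¹).tsum_eq (fun x => ENNReal.ofReal ((p x - p (x * g)) ^ 2))
    rw [← this]; simp
  simp_rw [e1, e2] at h1
  rw [lintegral_const, measure_univ, mul_one] at h1
  have e3 : ENNReal.ofReal (∑ x ∈ A, ∫ g, (p x - p (x * g)) ^ 2 ∂μ) ≤
      ∫⁻ g, ∑' x, ENNReal.ofReal ((p x - p (x * g)) ^ 2) ∂μ := by
    rw [ENNReal.ofReal_sum_of_nonneg fun x _ => integral_nonneg fun g => sq_nonneg _]
    have : ∀ x ∈ A, ENNReal.ofReal (∫ g, (p x - p (x * g)) ^ 2 ∂μ) =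
        ∫⁻ g, ENNReal.ofReal ((p x - p (x * g)) ^ 2) ∂μ := fun x _ =>
      ofReal_integral_eq_lintegral_ofReal (integrable_of_abs_le _ 1 fun g => hb2 _ _)
        (.of_forall fun g => sq_nonneg _)
    rw [Finset.sum_congr rfl this, ← lintegral_finsetSum _ fun _ _ => Measurable.of_discrete]
    exact lintegral_mono fun g => ENNReal.sum_le_tsum _
  have h2 := (add_le_add_right (mul_le_mul_right e3 (ENNReal.ofReal (γ / 4)))
    (ENNReal.ofReal (collision (ν ∗ₘ μ)))).trans h1
  have h0 : 0 ≤ ∑ x ∈ A, ∫ g, (p x - p (x * g)) ^ 2 ∂μ :=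
    Finset.sum_nonneg fun x _ => integral_nonneg fun g => sq_nonneg _
  rw [← ENNReal.ofReal_mul (by positivity), ← ENNReal.ofReal_add (collision_pos _).le
    (by positivity), ENNReal.ofReal_le_ofReal_iff (collision_pos _).le] at h2
  exact h2

/-- Decay of the collision probability `t` under a lazy step, given a lower bound `φ` on the
boundary flow of the sets with at most `4 / t` points. -/
lemma collision_mconv_le (ν μ : Measure G) [IsProbabilityMeasure ν] [IsProbabilityMeasure μ]
    (γ φ : ℝ) (hγ0 : 0 ≤ γ) (hγ : γ ≤ μ.real {1}) (hφ0 : 0 < φ)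
    (hφ : ∀ B : Finset G, (B.card : ℝ) ≤ 4 / collision ν →
      φ * B.card ≤ ∑ x ∈ B, μ.real {g | x * g ∉ B}) :
    collision (ν ∗ₘ μ) ≤ collision ν * (1 - γ / 32 * φ ^ 2) := by
  classical
  set t := collision ν with ht
  have ht0 : 0 < t := collision_pos ν
  set p : G → ℝ := fun x => ν.real {x} with hp
  have hp0 (x) : 0 ≤ p x := measureReal_nonneg
  have hp1 := hasSum_measureReal_singleton ν
  have hcard (B : Finset G) (hB : ∀ x ∈ B, t / 4 ≤ p x) : (B.card : ℝ) ≤ 4 / t := by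
    have h1 : B.card • (t / 4) ≤ ∑ x ∈ B, p x := Finset.card_nsmul_le_sum _ _ _ hB
    have h2 : ∑ x ∈ B, p x ≤ 1 := sum_le_hasSum _ (fun x _ => hp0 x) hp1
    rw [le_div_iff₀ ht0]
    simp only [nsmul_eq_mul] at h1
    linarith
  have hfin : {x | t / 4 < p x}.Finite := by
    by_contra h
    obtain ⟨B, hB, hBc⟩ := Set.Infinite.exists_subset_card_eq h (⌊4 / t⌋₊ + 1)
    have := hcard B fun x hx => (hB hx).le
    rw [hBc] at this
    push_cast at this
    exact absurd (Nat.lt_floor_add_one (4 / t)) (not_lt.2 this)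
  set A := hfin.toFinset with hA
  have hmem (x) : x ∈ A ↔ t / 4 < p x := by simp [hA]
  -- Truncation at `t / 4`: the support has at most `4 / t` points, and
  -- `p ^ 2 - t / 2 * p ≤ f ^ 2` keeps half of the `ℓ²` mass.
  set f : G → ℝ := fun x => max (p x - t / 4) 0 with hf
  have hfA (x) (hx : x ∉ A) : f x = 0 := by
    rw [hmem, not_lt] at hx
    exact max_eq_right (by linarith)
  have h1 := cheeger_inequality μ φ 1 hφ0 A f (fun x => le_max_right _ _)
    (fun x => max_le (by
      have : p x ≤ 1 := measureReal_le_one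
      linarith) zero_le_one)
    hfA fun B hB => hφ B (hcard B fun x hx => ((hmem x).1 (hB hx)).le)
  have h2 : t / 2 ≤ ∑ x ∈ A, f x ^ 2 := by
    have hs1 := (summable_measureReal_singleton_sq ν).hasSum
    have hs2 := hs1.sub (hp1.mul_left (t / 2))
    have hs3 : HasSum (fun x => f x ^ 2) (∑ x ∈ A, f x ^ 2) :=
      hasSum_sum_of_ne_finset_zero fun x hx => by simp [hfA x hx]
    have := hasSum_le (fun x => ?_) hs2 hs3
    · change t - _ ≤ _ at this
      linarith
    · change p x ^ 2 - t / 2 * p x ≤ max (p x - t / 4) 0 ^ 2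
      rcases le_total (p x - t / 4) 0 with h | h
      · rw [max_eq_right h]
        nlinarith [hp0 x, mul_nonneg (hp0 x) ht0.le]
      · rw [max_eq_left h]; nlinarith [sq_nonneg t]
  have h3 : ∑ x ∈ A, ∫ g, (f x - f (x * g)) ^ 2 ∂μ ≤
      ∑ x ∈ A, ∫ g, (p x - p (x * g)) ^ 2 ∂μ := by
    have hle (x y) : (f x - f y) ^ 2 ≤ (p x - p y) ^ 2 := by
      rw [sq_le_sq]
      refine (abs_max_sub_max_le_abs _ _ _).trans (le_of_eq ?_)
      congr 1; ring
    have hb (x y) : |(p x - p y) ^ 2| ≤ 1 := by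
      rw [abs_of_nonneg (sq_nonneg _), sq_le_one_iff_abs_le_one, abs_le]
      have h2 : p x ≤ 1 := measureReal_le_one
      have h4 : p y ≤ 1 := measureReal_le_one
      constructor <;> linarith [hp0 x, hp0 y]
    refine Finset.sum_le_sum fun x _ => integral_mono (integrable_of_abs_le _ 1 fun g => ?_)
      (integrable_of_abs_le _ 1 fun g => hb _ _) fun g => hle _ _
    rw [abs_of_nonneg (sq_nonneg _)]
    exact (hle _ _).trans ((le_abs_self _).trans (hb _ _))
  have h4 := collision_mconv_add_le ν μ γ hγ0 hγ A
  change _ + γ / 4 * ∑ x ∈ A, ∫ g, (p x - p (x * g)) ^ 2 ∂μ ≤ t at h4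
  have h5 := mul_le_mul_of_nonneg_left (h1.trans h3) (by positivity : 0 ≤ γ / 4)
  have h6 := mul_le_mul_of_nonneg_left h2 (by positivity : 0 ≤ γ / 4 * (φ ^ 2 / 4))
  nlinarith

end Collision

/-! ### The isoperimetric profile and its integral -/

section Profile

variable {G : Type*} [Group G] [Countable G] [MeasurableSpace G] [DiscreteMeasurableSpace G]
  (μ : Measure G) [IsProbabilityMeasure μ]

lemma bottleneckRatio_eq (A : Finset G) :
    bottleneckRatio μ A = (∑ x ∈ A, μ.real {g | x * g ∉ A}) / A.card := by
  rw [bottleneckRatio, stepFlow_compl_eq_sum, ENNReal.toReal_sum fun _ _ => measure_ne_top _ _]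
  rfl

omit [Countable G] [DiscreteMeasurableSpace G] [IsProbabilityMeasure μ] in
lemma bottleneckRatio_nonneg (A : Finset G) : 0 ≤ bottleneckRatio μ A :=
  div_nonneg ENNReal.toReal_nonneg (Nat.cast_nonneg _)

omit [Countable G] [DiscreteMeasurableSpace G] [IsProbabilityMeasure μ] in
lemma isoperimetricProfile_le {r : ℝ} {A : Finset G} (hA : A.Nonempty) (hr : (A.card : ℝ) ≤ r) :
    isoperimetricProfile μ r ≤ bottleneckRatio μ A :=
  csInf_le ⟨0, by rintro _ ⟨B, -, -, rfl⟩; exact bottleneckRatio_nonneg μ B⟩ ⟨A, hA, hr, rfl⟩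

omit [Countable G] [DiscreteMeasurableSpace G] [IsProbabilityMeasure μ] in
lemma le_isoperimetricProfile {r c : ℝ} (hr : 1 ≤ r)
    (h : ∀ A : Finset G, A.Nonempty → (A.card : ℝ) ≤ r → c ≤ bottleneckRatio μ A) :
    c ≤ isoperimetricProfile μ r :=
  le_csInf ⟨_, {1}, Finset.singleton_nonempty 1, by simpa using hr, rfl⟩
    (by rintro _ ⟨A, hA, hAr, rfl⟩; exact h A hA hAr)

lemma isoperimetricProfile_mul_card_le {r : ℝ} {A : Finset G} (hr : (A.card : ℝ) ≤ r) :
    isoperimetricProfile μ r * A.card ≤ ∑ x ∈ A, μ.real {g | x * g ∉ A} := by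
  rcases A.eq_empty_or_nonempty with rfl | hA
  · simp
  have h := isoperimetricProfile_le μ hA hr
  rwa [bottleneckRatio_eq, le_div_iff₀ (by exact_mod_cast hA.card_pos)] at h

lemma isoperimetricProfile_le_one {r : ℝ} (hr : 1 ≤ r) : isoperimetricProfile μ r ≤ 1 := by
  refine (isoperimetricProfile_le μ (Finset.singleton_nonempty 1) (by simpa using hr)).trans ?_
  rw [bottleneckRatio_eq]
  simp

omit [Countable G] [DiscreteMeasurableSpace G] [IsProbabilityMeasure μ] in
lemma isoperimetricProfile_anti {r s : ℝ} (hr : 1 ≤ r) (hrs : r ≤ s) :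
    isoperimetricProfile μ s ≤ isoperimetricProfile μ r :=
  le_isoperimetricProfile μ hr fun _ hA h => isoperimetricProfile_le μ hA (h.trans hrs)

omit [Countable G] [DiscreteMeasurableSpace G] in
/-- A path of positive probability from `x` to `y`, translated so as to lead from inside `A` to
outside `A`, leaves `A` at some step. The weight of that step bounds the boundary flow of `A` below,
uniformly over `A`. -/
lemma exists_pos_le_sum_of_stepKernelPow_pos {n : ℕ} :
    ∀ {x y : G}, 0 < stepKernelPow μ n x y → ∃ δ > 0, ∀ (A : Finset G) (a : G),
      a * x ∈ A → a * y ∉ A → δ ≤ ∑ z ∈ A, μ.real {g | z * g ∉ A} := by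
  induction n with
  | zero =>
    intro x y h
    have : x = y := by
      by_contra hxy
      simp [stepKernelPow, hxy] at h
    exact ⟨1, one_pos, fun A a h1 h2 => absurd (this ▸ h1) h2⟩
  | succ n ih =>
    intro x y h
    rw [stepKernelPow, pos_iff_ne_zero, Ne, ENNReal.tsum_eq_zero] at h
    push Not at h
    obtain ⟨z, hz⟩ := h
    obtain ⟨δ, hδ, H⟩ := ih (pos_iff_ne_zero.2 (right_ne_zero_of_mul hz))
    have hk : 0 < μ.real {x⁻¹ * z} :=
      ENNReal.toReal_pos (left_ne_zero_of_mul hz) (measure_ne_top _ _)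
    refine ⟨min δ (μ.real {x⁻¹ * z}), lt_min hδ hk, fun A a h1 h2 => ?_⟩
    by_cases h3 : a * z ∈ A
    · exact (min_le_left _ _).trans (H A a h3 h2)
    · refine (min_le_right _ _).trans (le_trans ?_ (Finset.single_le_sum
        (f := fun z => μ.real {g | z * g ∉ A}) (fun _ _ => measureReal_nonneg) h1))
      refine measureReal_mono (Set.singleton_subset_iff.2 ?_)
      change a * x * (x⁻¹ * z) ∉ A
      rwa [mul_assoc, mul_inv_cancel_left]

/-- With more than `r` reachable group elements `y` at hand, every `a ∈ A` with `A.card ≤ r` has some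
`a * y` outside `A`; the least of the finitely many path weights is then a lower bound. -/
lemma isoperimetricProfile_pos [Infinite G] (hμ : IsIrreducibleStep μ) {r : ℝ} (hr : 1 ≤ r) :
    0 < isoperimetricProfile μ r := by
  obtain ⟨Y, hY⟩ := Infinite.exists_subset_card_eq G (⌊r⌋₊ + 1)
  have h (y : G) : ∃ δ > 0, ∀ (A : Finset G) (a : G),
      a ∈ A → a * y ∉ A → δ ≤ ∑ z ∈ A, μ.real {g | z * g ∉ A} := by
    obtain ⟨n, hn⟩ := hμ 1 y
    simpa using exists_pos_le_sum_of_stepKernelPow_pos μ hn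
  choose δ hδ H using h
  have hYne : Y.Nonempty := Finset.card_pos.1 (by omega)
  obtain ⟨y₀, hy₀, hmin⟩ := Y.exists_min_image δ hYne
  refine (div_pos (hδ y₀) (by linarith : 0 < r)).trans_le
    (le_isoperimetricProfile μ hr fun A hA hAr => ?_)
  obtain ⟨a, ha⟩ := hA
  obtain ⟨y, hy, hya⟩ : ∃ y ∈ Y, a * y ∉ A := by
    by_contra! hc
    have h1 : Y.card ≤ A.card := Finset.card_le_card_of_injOn (fun y => a * y) hc
      (fun _ _ _ _ h => mul_left_cancel h)
    have h2 : (Y.card : ℝ) ≤ r := (Nat.cast_le.2 h1).trans hAr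
    rw [hY] at h2
    push_cast at h2
    linarith [Nat.lt_floor_add_one r]
  have hc : (0 : ℝ) < A.card := by exact_mod_cast Finset.card_pos.2 ⟨a, ha⟩
  rw [bottleneckRatio_eq]
  have h1 := (hmin y hy).trans (H y A a ha hya)
  have h0 := (hδ y₀).le
  gcongr

end Profile

section Integral

variable {G : Type*} [Group G] [Countable G] [Infinite G] [MeasurableSpace G]
  [DiscreteMeasurableSpace G] (μ : Measure G) [IsProbabilityMeasure μ]

lemma intervalIntegrable_profile (hμ : IsIrreducibleStep μ) {a b : ℝ} (ha : 1 ≤ a) (hb : 1 ≤ b) :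
    IntervalIntegrable (fun r => 1 / (r * isoperimetricProfile μ r ^ 2)) volume a b := by
  have h1 : MonotoneOn (fun r => 1 / isoperimetricProfile μ r ^ 2) (Set.uIcc a b) := by
    intro x hx y hy hxy
    have hx1 : 1 ≤ x := (le_min ha hb).trans hx.1
    have hy1 : 1 ≤ y := (le_min ha hb).trans hy.1
    have p1 := isoperimetricProfile_pos μ hμ hy1
    have p2 := isoperimetricProfile_anti μ hx1 hxy
    simp only
    gcongr
  have h2 : ContinuousOn (fun r : ℝ => r⁻¹) (Set.uIcc a b) :=
    continuousOn_inv₀.mono fun x hx => by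
      have hx1 : 1 ≤ x := (le_min ha hb).trans hx.1
      exact (zero_lt_one.trans_le hx1).ne'
  refine (h1.intervalIntegrable.continuousOn_mul h2).congr fun r _ => ?_
  rw [one_div, one_div, mul_inv]

lemma log_div_le_integral_profile (hμ : IsIrreducibleStep μ) {a b : ℝ} (ha : 1 ≤ a) (hab : a ≤ b) :
    Real.log (b / a) / isoperimetricProfile μ a ^ 2 ≤
      ∫ r in a..b, 1 / (r * isoperimetricProfile μ r ^ 2) := by
  have ha0 : 0 < a := zero_lt_one.trans_le ha
  have hi : IntervalIntegrable (fun r : ℝ => r⁻¹ / isoperimetricProfile μ a ^ 2) volume a b :=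
    (intervalIntegral.intervalIntegrable_inv (fun x hx => by
      rw [Set.uIcc_of_le hab] at hx; exact (ha0.trans_le hx.1).ne') continuousOn_id).div_const _
  rw [← integral_inv_of_pos ha0 (ha0.trans_le hab), ← intervalIntegral.integral_div]
  refine intervalIntegral.integral_mono_on hab hi
    (intervalIntegrable_profile μ hμ ha (ha.trans hab)) fun r hr => ?_
  have h1 : 1 ≤ r := ha.trans hr.1
  have p1 := isoperimetricProfile_pos μ hμ h1
  have p2 := isoperimetricProfile_anti μ ha hr.1
  rw [div_eq_mul_inv, one_div, mul_inv]
  have : 0 < r := by linarith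
  gcongr

/-- Appending a lazy `μ`-letter raises the potential `∫ r in 4..4 / t, 1 / (r * Φ r ^ 2)` of the
collision probability `t` by at least `γ / 32`. -/
lemma integral_profile_mconv (hμ : IsIrreducibleStep μ) {γ : ℝ} (hγ0 : 0 ≤ γ)
    (hγ : γ ≤ μ.real {1}) (ν : Measure G) [IsProbabilityMeasure ν] :
    (∫ r in (4 : ℝ)..(4 / collision ν), 1 / (r * isoperimetricProfile μ r ^ 2)) + γ / 32 ≤
      ∫ r in (4 : ℝ)..(4 / collision (ν ∗ₘ μ)), 1 / (r * isoperimetricProfile μ r ^ 2) := by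
  set t := collision ν
  set t' := collision (ν ∗ₘ μ)
  have ht : 0 < t := collision_pos ν
  have ht' : 0 < t' := collision_pos _
  have h4 : 4 ≤ 4 / t := by
    rw [le_div_iff₀ ht]; linarith [collision_le_one ν]
  set φ := isoperimetricProfile μ (4 / t) with hφ
  have hφ0 : 0 < φ := isoperimetricProfile_pos μ hμ (by linarith)
  have hle : t' ≤ t * (1 - γ / 32 * φ ^ 2) := collision_mconv_le ν μ γ φ hγ0 hγ hφ0
    fun B hB => isoperimetricProfile_mul_card_le μ hB
  have hs : 0 ≤ γ / 32 * φ ^ 2 := by positivity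
  have hle' : t' ≤ t := hle.trans (mul_le_of_le_one_right ht.le (by linarith))
  have h44 : 4 / t ≤ 4 / t' := by gcongr
  rw [← intervalIntegral.integral_add_adjacent_intervals
    (intervalIntegrable_profile μ hμ (by norm_num) (by linarith : 1 ≤ 4 / t))
    (intervalIntegrable_profile μ hμ (by linarith) (by linarith : 1 ≤ 4 / t'))]
  refine add_le_add_right (le_trans ?_ (log_div_le_integral_profile μ hμ (by linarith) h44)) _
  rw [← hφ, le_div_iff₀ (by positivity)]
  have e : 4 / t' / (4 / t) = (t' / t)⁻¹ := by field_simp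
  rw [e, Real.log_inv]
  have h1 := Real.log_le_sub_one_of_pos (div_pos ht' ht)
  have h2 : t' / t ≤ 1 - γ / 32 * φ ^ 2 := by rw [div_le_iff₀ ht]; linarith
  linarith

lemma integral_profile_mono (hμ : IsIrreducibleStep μ) {a b : ℝ} (ha : 4 ≤ a) (hab : a ≤ b) :
    (∫ r in (4 : ℝ)..a, 1 / (r * isoperimetricProfile μ r ^ 2)) ≤
      ∫ r in (4 : ℝ)..b, 1 / (r * isoperimetricProfile μ r ^ 2) := by
  rw [← intervalIntegral.integral_add_adjacent_intervals
    (intervalIntegrable_profile μ hμ (by norm_num) (by linarith : 1 ≤ a))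
    (intervalIntegrable_profile μ hμ (by linarith) (by linarith : 1 ≤ b))]
  refine le_add_of_nonneg_right (intervalIntegral.integral_nonneg hab fun r hr => ?_)
  have : 0 ≤ r := by linarith [hr.1]
  positivity

end Integral

/-! ### Words in independent letters -/

section Word

variable {G : Type*} [Group G]

/-- The product `z 0 * z 1 * ⋯ * z (l - 1)`. -/
def wordProd (z : ℕ → G) : ℕ → G
  | 0 => 1
  | l + 1 => wordProd z l * z l

lemma wordProd_congr {z z' : ℕ → G} {l : ℕ} (h : ∀ k < l, z k = z' k) :
    wordProd z l = wordProd z' l := by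
  induction l with
  | zero => rfl
  | succ l ih =>
    rw [wordProd, wordProd, ih fun k hk => h k (by omega), h l (by omega)]

lemma wordProd_add (z : ℕ → G) (a l : ℕ) :
    wordProd z (a + l) = wordProd z a * wordProd (fun k => z (a + k)) l := by
  induction l with
  | zero => simp [wordProd]
  | succ l ih => rw [← add_assoc, wordProd, ih, wordProd, mul_assoc]

variable [Countable G] [MeasurableSpace G] [DiscreteMeasurableSpace G]

lemma measurable_wordProd {A : Type*} [MeasurableSpace A] {z : A → ℕ → G}
    (hz : ∀ k, Measurable fun a => z a k) (l : ℕ) : Measurable fun a => wordProd (z a) l := by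
  induction l with
  | zero => exact measurable_const
  | succ l ih => exact ih.mul (hz l)

variable {Ω : Type*} [MeasurableSpace Ω] {P : Measure Ω} [IsProbabilityMeasure P]

omit [IsProbabilityMeasure P] in
lemma indepFun_wordProd {Z : ℕ → Ω → G} (hZ : ∀ k, Measurable (Z k)) (hi : iIndepFun Z P)
    (a b : ℕ) : IndepFun (fun ω => wordProd (fun k => Z k ω) a)
      (fun ω => wordProd (fun k => Z (a + k) ω) b) P := by
  have h := hi.indepFun_finset (Finset.range a) (Finset.Ico a (a + b))
    (by rw [Finset.disjoint_left]; intro x; simp; omega) hZ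
  have h2 := h.comp
    (φ := fun v => wordProd (fun k => if h : k ∈ Finset.range a then v ⟨k, h⟩ else 1) a)
    (ψ := fun v => wordProd
      (fun k => if h : a + k ∈ Finset.Ico a (a + b) then v ⟨a + k, h⟩ else 1) b)
    Measurable.of_discrete Measurable.of_discrete
  convert h2 using 1
  · funext ω
    exact wordProd_congr fun k hk => by simp [hk]
  · funext ω
    exact wordProd_congr fun k hk => by simp [hk]

lemma map_wordProd_add {Z : ℕ → Ω → G} (hZ : ∀ k, Measurable (Z k)) (hi : iIndepFun Z P)
    (a b : ℕ) : P.map (fun ω => wordProd (fun k => Z k ω) (a + b)) =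
      P.map (fun ω => wordProd (fun k => Z k ω) a) ∗ₘ
        P.map (fun ω => wordProd (fun k => Z (a + k) ω) b) := by
  rw [← (indepFun_wordProd hZ hi a b).map_mul_eq_map_mconv_map
    (measurable_wordProd hZ a) (measurable_wordProd (fun k => hZ (a + k)) b)]
  simp only [wordProd_add]
  rfl

lemma map_wordProd_succ {Z : ℕ → Ω → G} (hZ : ∀ k, Measurable (Z k)) (hi : iIndepFun Z P)
    (l : ℕ) : P.map (fun ω => wordProd (fun k => Z k ω) (l + 1)) =
      P.map (fun ω => wordProd (fun k => Z k ω) l) ∗ₘ P.map (Z l) := by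
  rw [map_wordProd_add hZ hi]
  simp [wordProd]

variable [Infinite G] {μ : Measure G} [IsProbabilityMeasure μ]

/-- The potential of a word grows at least linearly in the number of its `μ`-letters; the other
letters are constants. -/
lemma count_mul_le_integral_profile (hμ : IsIrreducibleStep μ) {γ : ℝ} (hγ0 : 0 ≤ γ)
    (hγ : γ ≤ μ.real {1}) {Z : ℕ → Ω → G} (hZ : ∀ k, Measurable (Z k)) (hi : iIndepFun Z P)
    (p : ℕ → Prop) [DecidablePred p] (hp : ∀ k, p k → P.map (Z k) = μ)
    (hnp : ∀ k, ¬ p k → ∃ h, P.map (Z k) = Measure.dirac h) (l : ℕ) :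
    γ / 32 * Nat.count p l ≤
      ∫ r in (4 : ℝ)..(4 / collision (P.map fun ω => wordProd (fun k => Z k ω) l)),
        1 / (r * isoperimetricProfile μ r ^ 2) := by
  have hprob (l : ℕ) : IsProbabilityMeasure (P.map fun ω => wordProd (fun k => Z k ω) l) :=
    Measure.isProbabilityMeasure_map (measurable_wordProd hZ l).aemeasurable
  induction l with
  | zero =>
    simp only [Nat.count_zero, Nat.cast_zero, mul_zero]
    have := collision_le_one (P.map fun ω => wordProd (fun k => Z k ω) 0)
    have h0 := collision_pos (P.map fun ω => wordProd (fun k => Z k ω) 0)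
    have h4 : 4 ≤ 4 / collision (P.map fun ω => wordProd (fun k => Z k ω) 0) := by
      rw [le_div_iff₀ h0]; linarith
    have := integral_profile_mono μ hμ le_rfl h4
    rwa [intervalIntegral.integral_same] at this
  | succ l ih =>
    rw [map_wordProd_succ hZ hi]
    by_cases hl : p l
    · rw [hp l hl, Nat.count_succ, if_pos hl]
      refine le_trans ?_ (integral_profile_mconv μ hμ hγ0 hγ _)
      push_cast
      linarith
    · obtain ⟨h, hh⟩ := hnp l hl
      rw [hh, collision_mconv_dirac, Nat.count_succ, if_neg hl]
      exact ih

lemma exists_count_eq (p : ℕ → Prop) [DecidablePred p] {k n : ℕ} (h : k ≤ Nat.count p n) :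
    ∃ a ≤ n, Nat.count p a = k := by
  induction n with
  | zero => exact ⟨0, le_rfl, by simp at h ⊢; omega⟩
  | succ n ih =>
    rcases Nat.lt_or_ge (Nat.count p n) k with h1 | h1
    · refine ⟨n + 1, le_rfl, le_antisymm ?_ h⟩
      rw [Nat.count_succ]; split_ifs <;> omega
    · obtain ⟨a, ha, h2⟩ := ih h1
      exact ⟨a, by omega, h2⟩

/-- A word with `2 * K` letters of law `μ` is cut into two words with at least `K` such letters
each. -/
lemma measureReal_wordProd_le (hμ : IsIrreducibleStep μ) {γ : ℝ} (hγ0 : 0 ≤ γ)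
    (hγ : γ ≤ μ.real {1}) {Z : ℕ → Ω → G} (hZ : ∀ k, Measurable (Z k)) (hi : iIndepFun Z P)
    (p : ℕ → Prop) [DecidablePred p] (hp : ∀ k, p k → P.map (Z k) = μ)
    (hnp : ∀ k, ¬ p k → ∃ h, P.map (Z k) = Measure.dirac h) {η : ℝ} (hη : 0 < η) {K n : ℕ}
    (hK : ∫ r in (4 : ℝ)..(4 / η), 1 / (r * isoperimetricProfile μ r ^ 2) < γ / 32 * K)
    (hn : 2 * K ≤ Nat.count p n) (x : G) :
    P.real {ω | wordProd (fun k => Z k ω) n = x} ≤ η := by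
  obtain ⟨a, ha, hca⟩ := exists_count_eq p (by omega : K ≤ Nat.count p n)
  obtain ⟨b, rfl⟩ := Nat.exists_eq_add_of_le ha
  have key (ν : Measure G) [IsProbabilityMeasure ν] (h : γ / 32 * K ≤
      ∫ r in (4 : ℝ)..(4 / collision ν), 1 / (r * isoperimetricProfile μ r ^ 2)) :
      collision ν ≤ η := by
    by_contra! hlt
    have h4 : 4 ≤ 4 / collision ν := by
      rw [le_div_iff₀ (collision_pos ν)]; linarith [collision_le_one ν]
    have h5 : 4 / collision ν ≤ 4 / η := by gcongr
    linarith [integral_profile_mono μ hμ h4 h5]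
  have m1 := measurable_wordProd (A := Ω) (z := fun ω k => Z k ω) hZ
  have m2 := measurable_wordProd (A := Ω) (z := fun ω k => Z (a + k) ω) (fun k => hZ _)
  have := Measure.isProbabilityMeasure_map (μ := P) (m1 a).aemeasurable
  have := Measure.isProbabilityMeasure_map (μ := P) (m2 b).aemeasurable
  have h1 := key _ (hca ▸ count_mul_le_integral_profile hμ hγ0 hγ hZ hi p hp hnp a)
  have h2 := count_mul_le_integral_profile hμ hγ0 hγ (fun k => hZ (a + k))
    (hi.precomp (add_right_injective a)) (fun k => p (a + k))
    (fun k => hp _) (fun k => hnp _) b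
  rw [Nat.count_add] at hn
  have hc : (K : ℝ) ≤ Nat.count (fun k => p (a + k)) b := by
    exact_mod_cast (by omega : K ≤ Nat.count (fun k => p (a + k)) b)
  have h3 := key _ ((mul_le_mul_of_nonneg_left hc (by positivity)).trans h2)
  have h4 := mconv_real_singleton_le (P.map fun ω => wordProd (fun k => Z k ω) a)
    (P.map fun ω => wordProd (fun k => Z (a + k) ω) b) x
  rw [← map_wordProd_add hZ hi, map_measureReal_apply (m1 _) MeasurableSet.of_discrete] at h4
  change P.real {ω | _} ≤ _ at h4
  exact h4.trans (by linarith)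

end Word

section Freezing

/-- Freezing one of two independent variables: a bound valid for every frozen value `v ∈ E` holds
for the joint variable on `V ∈ E`. -/
lemma measure_le_of_indepFun {Ω α β : Type*} [MeasurableSpace Ω] [MeasurableSpace α]
    [MeasurableSpace β] {P : Measure Ω} [IsProbabilityMeasure P] {V : Ω → α} {W : Ω → β}
    (hV : Measurable V) (hW : Measurable W) (h : IndepFun V W P) {B : Set (α × β)}
    (hB : MeasurableSet B) {E : Set α} (hE : MeasurableSet E) {c : ℝ≥0∞}
    (hc : ∀ v ∈ E, P {ω | (v, W ω) ∈ B} ≤ c) :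
    P {ω | V ω ∈ E ∧ (V ω, W ω) ∈ B} ≤ c := by
  have := Measure.isProbabilityMeasure_map (μ := P) hV.aemeasurable
  have := Measure.isProbabilityMeasure_map (μ := P) hW.aemeasurable
  have hB' : MeasurableSet (Prod.fst ⁻¹' E ∩ B) := (measurable_fst hE).inter hB
  have e : {ω | V ω ∈ E ∧ (V ω, W ω) ∈ B} = (fun ω => (V ω, W ω)) ⁻¹' (Prod.fst ⁻¹' E ∩ B) := rfl
  rw [e, ← Measure.map_apply (hV.prodMk hW) hB',
    (indepFun_iff_map_prod_eq_prod_map_map hV.aemeasurable hW.aemeasurable).1 h,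
    Measure.prod_apply hB']
  calc _ ≤ ∫⁻ _, c ∂(P.map V) := by
        refine lintegral_mono fun v => ?_
        by_cases hv : v ∈ E
        · rw [Measure.map_apply hW (measurable_prodMk_left hB')]
          exact (measure_mono fun ω hω => hω.2).trans (hc v hv)
        · have : Prod.mk v ⁻¹' (Prod.fst ⁻¹' E ∩ B) = ∅ := by
            ext y; simp [hv]
          simp [this]
    _ = c := by simp

variable {G : Type*} [Group G] [Countable G] [Infinite G] [MeasurableSpace G]
  [DiscreteMeasurableSpace G] {Ω : Type*} [MeasurableSpace Ω] {P : Measure Ω}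
  [IsProbabilityMeasure P] {μ : Measure G} [IsProbabilityMeasure μ]

/-- The letters outside `p` may be arbitrary functions of the samples outside `p`: these samples are
frozen, which turns the letters into constants. -/
lemma measure_wordProd_ite_le (hμ : IsIrreducibleStep μ) {γ : ℝ} (hγ0 : 0 ≤ γ)
    (hγ : γ ≤ μ.real {1}) {g : ℕ → Ω → G} (hg : ∀ k, Measurable (g k)) (hi : iIndepFun g P)
    (hlaw : ∀ k, P.map (g k) = μ)
    (p : ℕ → Prop) [DecidablePred p] {η : ℝ} (hη : 0 < η) {K n : ℕ}
    (hK : ∫ r in (4 : ℝ)..(4 / η), 1 / (r * isoperimetricProfile μ r ^ 2) < γ / 32 * K)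
    (hn : 2 * K ≤ Nat.count p n) (y : ℕ → (ℕ → G) → G)
    (hy : ∀ z z' : ℕ → G, (∀ i < n, ¬ p i → z i = z' i) → ∀ k < n, ¬ p k → y k z = y k z')
    (x : G) :
    P {ω | wordProd (fun k => if p k then g k ω else y k fun i => g i ω) n = x} ≤
      ENNReal.ofReal η := by
  classical
  set s := (Finset.range n).filter fun i => ¬ p i with hs
  set s' := (Finset.range n).filter p with hs'
  have hind := hi.indepFun_finset s s'
    (Finset.disjoint_filter_filter_not _ _ _).symm hg
  set V : Ω → (s → G) := fun ω i => g i ω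
  set W : Ω → (s' → G) := fun ω i => g i ω
  let B : Set ((s → G) × (s' → G)) := {vw | wordProd (fun k => if p k then
    (if h : k ∈ s' then vw.2 ⟨k, h⟩ else 1) else
    y k fun i => if h : i ∈ s then vw.1 ⟨i, h⟩ else 1) n = x}
  have h := measure_le_of_indepFun (P := P) (V := V) (W := W)
    (measurable_pi_lambda _ fun i => hg i) (measurable_pi_lambda _ fun i => hg i) hind
    (B := B) MeasurableSet.of_discrete (E := Set.univ) MeasurableSet.univ
    (c := ENNReal.ofReal η) (fun v _ => by
      set Z : ℕ → Ω → G := fun k ω => if p k then g k ω else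
        y k fun i => if h : i ∈ s then v ⟨i, h⟩ else 1 with hZdef
      have hZi : iIndepFun Z P := hi.comp (fun k a => if p k then a else
        y k fun i => if h : i ∈ s then v ⟨i, h⟩ else 1) fun _ => Measurable.of_discrete
      have hZm (k) : Measurable (Z k) := by
        by_cases hk : p k
        · simpa [hZdef, hk] using hg k
        · simp [hZdef, hk]
      have := measureReal_wordProd_le hμ hγ0 hγ hZm hZi p
        (fun k hk => by simp only [hZdef, hk, if_true]; exact hlaw k)
        (fun k hk => ⟨_, by
          simp only [hZdef, hk, if_false]
          rw [Measure.map_const, measure_univ, one_smul]⟩) hη hK hn x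
      have e : {ω | (v, W ω) ∈ B} = {ω | wordProd (fun k => Z k ω) n = x} := by
        ext ω
        simp only [B, Set.mem_ofPred_eq, W, hZdef]
        rw [wordProd_congr]
        intro k hk
        by_cases hpk : p k <;> simp [hpk, hs', hk]
      rw [e, ← ofReal_measureReal (measure_ne_top _ _)]
      exact ENNReal.ofReal_le_ofReal this)
  refine le_of_eq_of_le (congrArg P ?_) h
  ext ω
  simp only [B, Set.mem_ofPred_eq, V, W, Set.mem_univ, true_and]
  rw [wordProd_congr]
  intro k hk
  by_cases hpk : p k
  · simp [hpk, hs', hk]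
  · simp only [hpk, if_false]
    exact hy _ _ (fun i hi hpi => by simp [hs, hi, hpi]) k hk hpk

end Freezing

/-! ### Exponential bound on the number of uncopied fresh steps -/

section Concentration

variable {Ω : Type*} [MeasurableSpace Ω] {P : Measure Ω} [IsProbabilityMeasure P]

omit [IsProbabilityMeasure P] in
lemma lintegral_ite_const (s : Set Ω) (hs : MeasurableSet s) [DecidablePred (· ∈ s)] (c d : ℝ≥0∞) :
    ∫⁻ ω, (if ω ∈ s then c else d) ∂P = c * P s + d * P sᶜ := by
  have e : (fun ω => if ω ∈ s then c else d) =
      fun ω => s.indicator (fun _ => c) ω + sᶜ.indicator (fun _ => d) ω := by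
    funext ω
    by_cases h : ω ∈ s <;> simp [h]
  rw [e, lintegral_add_left (measurable_const.indicator hs), lintegral_indicator_const hs,
    lintegral_indicator_const hs.compl]

/-- Fubini's theorem for independent variables, as an inequality for conditional expectations given
`V`. -/
lemma lintegral_comp_pair_le {α β : Type*} [MeasurableSpace α] [MeasurableSpace β] {V : Ω → α}
    {W : Ω → β} (hV : Measurable V) (hW : Measurable W) (h : IndepFun V W P)
    {f : α × β → ℝ≥0∞} (hf : Measurable f) {b : α → ℝ≥0∞} (hb : Measurable b)
    (hle : ∀ v, ∫⁻ ω, f (v, W ω) ∂P ≤ b v) :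
    ∫⁻ ω, f (V ω, W ω) ∂P ≤ ∫⁻ ω, b (V ω) ∂P := by
  have := Measure.isProbabilityMeasure_map (μ := P) hV.aemeasurable
  have := Measure.isProbabilityMeasure_map (μ := P) hW.aemeasurable
  rw [← lintegral_map hf (hV.prodMk hW),
    (indepFun_iff_map_prod_eq_prod_map_map hV.aemeasurable hW.aemeasurable).1 h,
    lintegral_prod _ hf.aemeasurable, ← lintegral_map hb hV]
  refine lintegral_mono fun v => ?_
  rw [lintegral_map (f := fun w => f (v, w)) (hf.comp measurable_prodMk_left) hW]
  exact hle v

/-- The indices of a window of length `m` at which no reinforcement takes place. -/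
def freshSet {m : ℕ} (b : Fin m → Bool) : Finset (Fin m) := Finset.univ.filter fun i => b i = false

/-- The indices `i` of a window starting at time `a` whose uniform choice `v i` falls on an earlier
unreinforced time `a + j` of the window. Whether `i` itself is reinforced is disregarded, which only
enlarges the set and makes the events independent given `b`. -/
def hitSet {m : ℕ} (a : ℕ) (b : Fin m → Bool) (v : Fin m → ℕ) : Finset (Fin m) :=
  Finset.univ.filter fun i => ∃ j ∈ freshSet b, j < i ∧ v i = a + j

/-- For a fixed reinforcement pattern `b`, each time hits the fresh set with probability at most
`δ * (freshSet b).card`, independently. -/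
lemma lintegral_two_pow_hitSet_le {m : ℕ} {u : Fin m → Ω → ℕ} (hu : ∀ i, Measurable (u i))
    (hiu : iIndepFun u P) {a : ℕ} {δ : ℝ}
    (hlaw : ∀ i j : Fin m, j < i → P.real {ω | u i ω = a + j} ≤ δ) (hδ0 : 0 ≤ δ)
    (hδ : m * δ ≤ 1 / 4) (b : Fin m → Bool) :
    ∫⁻ ω, 2 ^ (hitSet a b (fun i => u i ω)).card ∂P ≤
      ENNReal.ofReal ((3 / 2) ^ (freshSet b).card) := by
  classical
  set R := freshSet b
  let s : Fin m → Set ℕ := fun i => {k | ∃ j ∈ R, j < i ∧ k = a + j}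
  have e (ω : Ω) : (2 : ℝ≥0∞) ^ (hitSet a b (fun i => u i ω)).card =
      ∏ i, if u i ω ∈ s i then (2 : ℝ≥0∞) else 1 := by
    rw [← Finset.prod_filter, Finset.prod_const]
    rfl
  simp_rw [e]
  have hX : iIndepFun (fun i ω => if u i ω ∈ s i then (2 : ℝ≥0∞) else 1) P :=
    hiu.comp (fun i k => if k ∈ s i then (2 : ℝ≥0∞) else 1) fun _ => Measurable.of_discrete
  rw [lintegral_prod_eq_prod_lintegral_of_indepFun _ _ hX fun i =>
    (Measurable.of_discrete (f := fun k => if k ∈ s i then (2 : ℝ≥0∞) else 1)).comp (hu i)]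
  have hone (i : Fin m) : ∫⁻ ω, (if u i ω ∈ s i then (2 : ℝ≥0∞) else 1) ∂P ≤
      ENNReal.ofReal (1 + R.card * δ) := by
    have hms : MeasurableSet (u i ⁻¹' s i) := hu i MeasurableSet.of_discrete
    have h1 := lintegral_ite_const (P := P) (u i ⁻¹' s i) hms 2 1
    simp only [Set.mem_preimage] at h1
    rw [h1, one_mul, two_mul, add_assoc, measure_add_measure_compl hms, measure_univ, add_comm,
      ENNReal.ofReal_add zero_le_one (by positivity), ENNReal.ofReal_one,
      ← ofReal_measureReal (measure_ne_top _ _)]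
    refine add_le_add_right (ENNReal.ofReal_le_ofReal ?_) _
    have hsub : u i ⁻¹' s i ⊆ ⋃ j ∈ R.filter (· < i), {ω | u i ω = a + j} := by
      rintro ω ⟨j, hj, hji, h⟩
      simp only [Set.mem_iUnion]
      exact ⟨j, Finset.mem_filter.2 ⟨hj, hji⟩, h⟩
    refine (measureReal_mono hsub (measure_ne_top _ _)).trans ((measureReal_biUnion_finset_le _ _).trans ?_)
    refine (Finset.sum_le_sum fun j hj => hlaw i j (Finset.mem_filter.1 hj).2).trans ?_
    rw [Finset.sum_const, nsmul_eq_mul]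
    gcongr
    exact Finset.filter_subset _ _
  refine (Finset.prod_le_prod' fun i _ => hone i).trans ?_
  rw [Finset.prod_const, Finset.card_univ, Fintype.card_fin, ← ENNReal.ofReal_pow (by positivity)]
  refine ENNReal.ofReal_le_ofReal ?_
  have hexp : Real.exp (1 / 4) ≤ 3 / 2 := by
    have h4 : Real.exp (1 / 4) ^ 4 = Real.exp 1 := by rw [← Real.exp_nat_mul]; norm_num
    have : Real.exp (1 / 4) ^ 4 ≤ (3 / 2) ^ 4 := by
      rw [h4]; linarith [Real.exp_one_lt_d9]
    exact le_of_pow_le_pow_left₀ (by norm_num) (by norm_num) this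
  calc (1 + R.card * δ) ^ m ≤ Real.exp (R.card * δ) ^ m := by
        gcongr; linarith [Real.add_one_le_exp (R.card * δ)]
    _ = Real.exp (R.card * (m * δ)) := by rw [← Real.exp_nat_mul]; ring_nf
    _ ≤ Real.exp (R.card * (1 / 4)) := by gcongr
    _ = Real.exp (1 / 4) ^ R.card := by rw [← Real.exp_nat_mul]
    _ ≤ _ := by gcongr

lemma lintegral_three_quarters_pow_le {m : ℕ} {ξ : Fin m → Ω → Bool}
    (hξ : ∀ i, Measurable (ξ i)) (hiξ : iIndepFun ξ P) {α : ℝ} (hα0 : 0 ≤ α) (hα1 : α ≤ 1)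
    (hlaw : ∀ i, P.real {ω | ξ i ω = true} = α) :
    ∫⁻ ω, ENNReal.ofReal ((3 / 4) ^ (freshSet (fun i => ξ i ω)).card) ∂P ≤
      ENNReal.ofReal (Real.exp (-((1 - α) * m / 4))) := by
  classical
  have e (ω : Ω) : ENNReal.ofReal ((3 / 4) ^ (freshSet (fun i => ξ i ω)).card) =
      ∏ i, if ξ i ω = true then (1 : ℝ≥0∞) else ENNReal.ofReal (3 / 4) := by
    rw [ENNReal.ofReal_pow (by norm_num), ← Finset.prod_const, freshSet, Finset.prod_filter]
    refine Finset.prod_congr rfl fun i _ => ?_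
    cases ξ i ω <;> simp
  simp_rw [e]
  have hX : iIndepFun (fun i ω => if ξ i ω = true then (1 : ℝ≥0∞) else ENNReal.ofReal (3 / 4)) P :=
    hiξ.comp (fun i k => if k = true then (1 : ℝ≥0∞) else ENNReal.ofReal (3 / 4))
      fun _ => Measurable.of_discrete
  rw [lintegral_prod_eq_prod_lintegral_of_indepFun _ _ hX fun i =>
    (Measurable.of_discrete
      (f := fun k : Bool => if k = true then (1 : ℝ≥0∞) else ENNReal.ofReal (3 / 4))).comp (hξ i)]
  have hone (i : Fin m) :
      ∫⁻ ω, (if ξ i ω = true then (1 : ℝ≥0∞) else ENNReal.ofReal (3 / 4)) ∂P ≤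
      ENNReal.ofReal (Real.exp (-((1 - α) / 4))) := by
    have hms : MeasurableSet {ω | ξ i ω = true} := hξ i (MeasurableSet.singleton true)
    have h1 := lintegral_ite_const (P := P) {ω | ξ i ω = true} hms 1 (ENNReal.ofReal (3 / 4))
    simp only [Set.mem_ofPred_eq] at h1
    rw [h1, one_mul, ← ofReal_measureReal (measure_ne_top _ _),
      ← ofReal_measureReal (measure_ne_top P {ω | ξ i ω = true}ᶜ), ← ENNReal.ofReal_mul (by norm_num),
      probReal_compl_eq_one_sub hms, hlaw, ← ENNReal.ofReal_add hα0
        (mul_nonneg (by norm_num) (by linarith))]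
    refine ENNReal.ofReal_le_ofReal ?_
    linarith [Real.add_one_le_exp (-((1 - α) / 4))]
  refine (Finset.prod_le_prod' fun i _ => hone i).trans ?_
  rw [Finset.prod_const, Finset.card_univ, Fintype.card_fin, ← ENNReal.ofReal_pow (Real.exp_nonneg _),
    ← Real.exp_nat_mul]
  exact ENNReal.ofReal_le_ofReal (Real.exp_le_exp.2 (le_of_eq (by ring)))

/-- Chernoff bound in base `2` for the number of fresh times minus the number of hits: averaging over
`u` leaves a factor at most `1 / 2 * 3 / 2 = 3 / 4` for every fresh time. -/
lemma measureReal_freshSet_lt_le {m : ℕ} {ξ : Fin m → Ω → Bool} {u : Fin m → Ω → ℕ}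
    (hξ : ∀ i, Measurable (ξ i)) (hu : ∀ i, Measurable (u i))
    (hiξ : iIndepFun ξ P) (hiu : iIndepFun u P)
    (hind : IndepFun (fun ω i => ξ i ω) (fun ω i => u i ω) P)
    {α : ℝ} (hα0 : 0 ≤ α) (hα1 : α ≤ 1) (hlawξ : ∀ i, P.real {ω | ξ i ω = true} = α)
    {a : ℕ} {δ : ℝ} (hlaw : ∀ i j : Fin m, j < i → P.real {ω | u i ω = a + j} ≤ δ) (hδ0 : 0 ≤ δ)
    (hδ : m * δ ≤ 1 / 4) (K : ℕ) :
    P.real {ω | (freshSet fun i => ξ i ω).card <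
      K + (hitSet a (fun i => ξ i ω) (fun i => u i ω)).card} ≤
      Real.exp (K - (1 - α) * m / 4) := by
  let f : (Fin m → Bool) × (Fin m → ℕ) → ℝ≥0∞ := fun bv =>
    2⁻¹ ^ (freshSet bv.1).card * 2 ^ (hitSet a bv.1 bv.2).card
  have h1 := lintegral_comp_pair_le (P := P) (V := fun ω i => ξ i ω) (W := fun ω i => u i ω)
    (measurable_pi_lambda _ hξ) (measurable_pi_lambda _ hu) hind (f := f) Measurable.of_discrete
    (b := fun b => ENNReal.ofReal ((3 / 4) ^ (freshSet b).card)) Measurable.of_discrete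
    (fun b => by
      simp only [f]
      rw [lintegral_const_mul' _ _ (by simp)]
      refine (mul_le_mul_right (lintegral_two_pow_hitSet_le hu hiu hlaw hδ0 hδ b) _).trans ?_
      have : (2⁻¹ : ℝ≥0∞) = ENNReal.ofReal (1 / 2) := by
        rw [one_div, ENNReal.ofReal_inv_of_pos (by norm_num)]; norm_num
      rw [this, ← ENNReal.ofReal_pow (by norm_num), ← ENNReal.ofReal_mul (by positivity),
        ← mul_pow]
      norm_num)
  have h2 := h1.trans (lintegral_three_quarters_pow_le hξ hiξ hα0 hα1 hlawξ)
  have hsub : {ω | (freshSet fun i => ξ i ω).card <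
      K + (hitSet a (fun i => ξ i ω) (fun i => u i ω)).card} ⊆
      {ω | (2⁻¹ : ℝ≥0∞) ^ K ≤ f (fun i => ξ i ω, fun i => u i ω)} := by
    intro ω hω
    simp only [Set.mem_ofPred_eq, f] at hω ⊢
    set R := (freshSet fun i => ξ i ω).card
    set H := (hitSet a (fun i => ξ i ω) (fun i => u i ω)).card
    calc (2⁻¹ : ℝ≥0∞) ^ K = 2⁻¹ ^ K * (2⁻¹ ^ H * 2 ^ H) := by
          rw [← mul_pow, ENNReal.inv_mul_cancel (by norm_num) (by norm_num), one_pow, mul_one]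
      _ = 2⁻¹ ^ (K + H) * 2 ^ H := by rw [pow_add, mul_assoc]
      _ ≤ 2⁻¹ ^ R * 2 ^ H := by
          refine mul_le_mul_left (pow_le_pow_right_of_le_one' ?_ hω.le) _
          simp
  have h3 := mul_meas_ge_le_lintegral (μ := P) (f := fun ω => f (fun i => ξ i ω, fun i => u i ω))
    ((Measurable.of_discrete (f := f)).comp
      ((measurable_pi_lambda _ hξ).prodMk (measurable_pi_lambda _ hu))) (2⁻¹ ^ K)
  have h4 := ((mul_le_mul_right (measure_mono hsub) _).trans h3).trans h2
  have hK : (2⁻¹ : ℝ≥0∞) ^ K = ENNReal.ofReal ((1 / 2) ^ K) := by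
    rw [ENNReal.ofReal_pow (by norm_num), one_div, ENNReal.ofReal_inv_of_pos (by norm_num)]
    norm_num
  rw [hK, ← ofReal_measureReal (measure_ne_top _ _), ← ENNReal.ofReal_mul (by positivity),
    ENNReal.ofReal_le_ofReal_iff (Real.exp_nonneg _)] at h4
  set p := P.real _
  have h5 : p ≤ 2 ^ K * Real.exp (-((1 - α) * m / 4)) := by
    have := mul_le_mul_of_nonneg_left h4 (by positivity : (0 : ℝ) ≤ 2 ^ K)
    rwa [← mul_assoc, ← mul_pow, show (2 : ℝ) * (1 / 2) = 1 by norm_num, one_pow, one_mul] at this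
  refine h5.trans ?_
  rw [show K - (1 - α) * m / 4 = K + -((1 - α) * m / 4) by ring, Real.exp_add]
  gcongr
  calc (2 : ℝ) ^ K ≤ Real.exp 1 ^ K := by
        gcongr; linarith [Real.add_one_le_exp 1]
    _ = Real.exp K := by rw [← Real.exp_nat_mul, mul_one]

end Concentration

/-! ### Steps of the walk as functions of the data -/

section StepValue

variable {G : Type*} [Group G]

/-- The step at time `k + 1` as a function of the data `θ k = (ξ, u, T)` at time `k + 1` and of the
fresh samples `g k` at time `k + 1`. Invalid choices of the past step, which have probability zero,
give the value `1`. -/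
noncomputable def stepValue (θ : ℕ → Bool × ℕ × (G → G)) (g : ℕ → G) (k : ℕ) : G :=
  if (θ k).1 = true then
    if _h : 1 ≤ (θ k).2.1 ∧ (θ k).2.1 ≤ k then (θ k).2.2 (stepValue θ g ((θ k).2.1 - 1)) else 1
  else g k
termination_by k
decreasing_by omega

/-- The step at time `k + 1` is fresh and no reinforced step up to time `n` copies it directly; the
sample `g k` then enters the first `n` steps only once. -/
def IsUnrepeated (θ : ℕ → Bool × ℕ × (G → G)) (n k : ℕ) : Prop :=
  (θ k).1 = false ∧ ∀ j < n, k < j → (θ j).1 = true → (θ j).2.1 ≠ k + 1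

lemma stepValue_eq_ite (θ : ℕ → Bool × ℕ × (G → G)) (g : ℕ → G) (k : ℕ) :
    stepValue θ g k = if (θ k).1 = true then
      if 1 ≤ (θ k).2.1 ∧ (θ k).2.1 ≤ k then (θ k).2.2 (stepValue θ g ((θ k).2.1 - 1)) else 1
      else g k := by
  rw [stepValue]
  simp only [dite_eq_ite]

lemma stepValue_of_fresh {θ : ℕ → Bool × ℕ × (G → G)} {g : ℕ → G} {k : ℕ}
    (h : (θ k).1 = false) : stepValue θ g k = g k := by
  rw [stepValue_eq_ite]; simp [h]

/-- A step that is not unrepeated does not depend on the samples of the unrepeated ones: following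
its reinforcement history only visits steps that are copied. -/
lemma stepValue_congr {θ : ℕ → Bool × ℕ × (G → G)} {n : ℕ} {g g' : ℕ → G}
    (h : ∀ i < n, ¬ IsUnrepeated θ n i → g i = g' i) {k : ℕ} (hk : k < n)
    (hku : ¬ IsUnrepeated θ n k) : stepValue θ g k = stepValue θ g' k := by
  induction k using Nat.strong_induction_on with
  | _ k ih =>
  by_cases hξ : (θ k).1 = true
  · rw [stepValue_eq_ite θ g, stepValue_eq_ite θ g', if_pos hξ, if_pos hξ]
    split_ifs with hu
    · rw [ih _ (by omega) (by omega)]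
      exact fun hr => hr.2 k hk (by omega) hξ (by omega)
    · rfl
  · rw [Bool.not_eq_true] at hξ
    rw [stepValue_of_fresh hξ, stepValue_of_fresh hξ]
    exact h k hk hku

variable [Countable G] [MeasurableSpace G] [DiscreteMeasurableSpace G]

omit [Group G] [Countable G] [DiscreteMeasurableSpace G] in
/-- Evaluation of a random function at a random point of a countable space is measurable. -/
lemma measurable_apply_countable {A ι : Type*} [MeasurableSpace A] [MeasurableSpace ι] [Countable ι]
    [DiscreteMeasurableSpace ι] {f : ι → A → G} (hf : ∀ i, Measurable (f i)) {u : A → ι}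
    (hu : Measurable u) : Measurable fun a => f (u a) a :=
  (measurable_from_prod_countable_right (f := fun p : ι × A => f p.1 p.2) hf).comp
    (hu.prodMk measurable_id)

lemma measurable_stepValue {A : Type*} [MeasurableSpace A] {θ : A → ℕ → Bool × ℕ × (G → G)}
    {g : A → ℕ → G} (hθ : ∀ k, Measurable fun a => θ a k) (hg : ∀ k, Measurable fun a => g a k)
    (k : ℕ) : Measurable fun a => stepValue (θ a) (g a) k := by
  induction k using Nat.strong_induction_on with
  | _ k ih =>
  have hT : Measurable fun a => (θ a k).2.2 := (hθ k).snd.snd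
  have h1 (i : ℕ) : Measurable fun a => if 1 ≤ i ∧ i ≤ k then
      (θ a k).2.2 (stepValue (θ a) (g a) (i - 1)) else 1 := by
    by_cases hi : 1 ≤ i ∧ i ≤ k
    · simp only [hi, and_self, if_true]
      exact measurable_apply_countable (f := fun y a => (θ a k).2.2 y)
        (fun y => (measurable_pi_apply y).comp hT) (ih (i - 1) (by omega))
    · simp only [hi, if_false]
      exact measurable_const
  have h2 := measurable_apply_countable h1 (hθ k).snd.fst
  have h3 : MeasurableSet {a | (θ a k).1 = true} := (hθ k).fst (MeasurableSet.singleton true)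
  simp_rw [stepValue_eq_ite _ _ k]
  exact Measurable.ite h3 h2 (hg k)

omit [Group G] [Countable G] [DiscreteMeasurableSpace G] in
open Classical in
lemma measurable_count_isUnrepeated {A : Type*} [MeasurableSpace A]
    {θ : A → ℕ → Bool × ℕ × (G → G)} (hθ : ∀ k, Measurable fun a => θ a k) (n : ℕ) (l : ℕ) :
    Measurable fun a => Nat.count (IsUnrepeated (θ a) n) l := by
  induction l with
  | zero => simp
  | succ l ih =>
    simp only [Nat.count_succ]
    refine ih.add (Measurable.ite ?_ measurable_const measurable_const)
    have h1 (k : ℕ) (b : Bool) : MeasurableSet {a | (θ a k).1 = b} :=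
      (hθ k).fst (MeasurableSet.singleton b)
    have h2 (k i : ℕ) : MeasurableSet {a | (θ a k).2.1 = i} :=
      (hθ k).snd.fst (MeasurableSet.singleton i)
    have e : {a | IsUnrepeated (θ a) n l} = {a | (θ a l).1 = false} ∩
        ⋂ j, ⋂ (_ : j < n), ⋂ (_ : l < j), ({a | (θ a j).1 = true}ᶜ ∪ {a | (θ a j).2.1 = l + 1}ᶜ) := by
      ext a
      simp only [IsUnrepeated, Set.mem_ofPred_eq, Set.mem_inter_iff, Set.mem_iInter, Set.mem_union,
        Set.mem_compl_iff, imp_iff_not_or, ne_eq]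
    rw [e]
    exact (h1 _ _).inter (.iInter fun j => .iInter fun _ => .iInter fun _ =>
      (h1 _ _).compl.union (h2 _ _).compl)

variable [Infinite G] {Ω : Type*} [MeasurableSpace Ω] {P : Measure Ω}
  [IsProbabilityMeasure P] {μ : Measure G} [IsProbabilityMeasure μ]

open Classical in
lemma measure_wordProd_stepValue_le (hμ : IsIrreducibleStep μ) {γ : ℝ} (hγ0 : 0 ≤ γ)
    (hγ : γ ≤ μ.real {1}) {g : ℕ → Ω → G} (hg : ∀ k, Measurable (g k)) (hi : iIndepFun g P)
    (hlaw : ∀ k, P.map (g k) = μ) (θ : ℕ → Bool × ℕ × (G → G)) {η : ℝ} (hη : 0 < η) {K n : ℕ}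
    (hK : ∫ r in (4 : ℝ)..(4 / η), 1 / (r * isoperimetricProfile μ r ^ 2) < γ / 32 * K)
    (hn : 2 * K ≤ Nat.count (IsUnrepeated θ n) n) (x : G) :
    P {ω | wordProd (stepValue θ fun k => g k ω) n = x} ≤ ENNReal.ofReal η := by
  refine le_of_eq_of_le (congrArg P ?_) (measure_wordProd_ite_le hμ hγ0 hγ hg hi hlaw
    (IsUnrepeated θ n) hη hK hn (fun k z => stepValue θ z k)
    (fun z z' h k hk hku => stepValue_congr h hk hku) x)
  ext ω
  simp only [Set.mem_ofPred_eq]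
  rw [wordProd_congr]
  intro k hk
  by_cases h : IsUnrepeated θ n k
  · rw [if_pos h, stepValue_of_fresh h.1]
  · rw [if_neg h]

end StepValue

/-! ### The reinforced walk -/

section Walk

open Classical in
/-- Every fresh step among the last `m` that is copied directly is the choice of some hit, and
distinct steps belong to distinct hits. -/
lemma card_freshSet_le {G : Type*} (θ : ℕ → Bool × ℕ × (G → G)) (d m : ℕ) :
    (freshSet fun i : Fin m => (θ (d + i)).1).card ≤
      Nat.count (IsUnrepeated θ (d + m)) (d + m) +
        (hitSet (d + 1) (fun i : Fin m => (θ (d + i)).1) fun i => (θ (d + i)).2.1).card := by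
  set R := freshSet fun i : Fin m => (θ (d + i)).1
  have hR (i : Fin m) : i ∈ R ↔ (θ (d + i)).1 = false := by simp [R, freshSet]
  rw [← Finset.card_filter_add_card_filter_not (s := R)
    (fun i : Fin m => IsUnrepeated θ (d + m) (d + i))]
  refine add_le_add ?_ ?_
  · rw [Nat.count_eq_card_filter_range]
    refine Finset.card_le_card_of_injOn (fun i : Fin m => d + (i : ℕ)) (fun i hi => ?_)
      fun i _ j _ h => by ext; simpa using h
    have := (Finset.mem_filter.1 hi).2
    simp only [Finset.coe_filter, Finset.mem_range, Set.mem_ofPred_eq]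
    exact ⟨by omega, this⟩
  · let f : Fin m → Fin m := fun i =>
      if h : (θ (d + i)).2.1 - (d + 1) < m then ⟨_, h⟩ else i
    refine Finset.card_le_card_of_surjOn f fun i hi => ?_
    obtain ⟨hiR, hi⟩ := Finset.mem_filter.1 hi
    have hfresh := (hR i).1 hiR
    simp only [IsUnrepeated, hfresh, true_and] at hi
    push Not at hi
    obtain ⟨j, hj, hij, -, hju⟩ := hi
    obtain ⟨l, rfl⟩ := Nat.exists_eq_add_of_le (by omega : d ≤ j)
    refine ⟨⟨l, by omega⟩, ?_, ?_⟩
    · simp only [hitSet, Finset.coe_filter, Finset.mem_univ, true_and, Set.mem_ofPred_eq]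
      exact ⟨i, hiR, Fin.mk_lt_mk.2 (by simpa using hij), by rw [hju]; omega⟩
    · have h2 : (θ (d + l)).2.1 - (d + 1) = i := by rw [hju]; omega
      have h3 : (θ (d + l)).2.1 - (d + 1) < m := by rw [h2]; exact i.2
      ext
      simp [f, h2]

/-- Data indexed by the times `j ≥ 2`, shifted to the indices `k = j - 1 ≥ 0`. At `k = 0`, time `1`,
the step is declared fresh. -/
def extendData {G : Type*} (v : Set.Ici 2 → Bool × ℕ × (G → G)) (k : ℕ) : Bool × ℕ × (G → G) :=
  if h : 2 ≤ k + 1 then v ⟨k + 1, h⟩ else (false, 0, id)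

lemma measurable_extendData {G : Type*} [MeasurableSpace G] (k : ℕ) :
    Measurable fun v : Set.Ici 2 → Bool × ℕ × (G → G) => extendData v k := by
  by_cases h : 2 ≤ k + 1
  · simp only [extendData, h, dif_pos]; exact measurable_pi_apply _
  · simp only [extendData, h, dif_neg, not_false_eq_true]; exact measurable_const

namespace IsGeneralizedSRRW

variable {G : Type*} {Ω : Type*} [Group G] [MeasurableSpace G] [MeasurableSpace Ω]
  {P : Measure Ω} [IsProbabilityMeasure P] {α : ℝ} {μ : Measure G} {ξ : ℕ → Ω → Bool}
  {u : ℕ → Ω → ℕ} {T : ℕ → Ω → G → G} {g X S : ℕ → Ω → G}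
  (h : IsGeneralizedSRRW P α μ ξ u T g X S)

include h

lemma ae_mem_Ico (j : ℕ) (hj : 2 ≤ j) : ∀ᵐ ω ∂P, u j ω ∈ Finset.Ico 1 j := by
  have hm : MeasurableSet {ω | u j ω ∈ Finset.Ico 1 j} := h.measurable_u j hj MeasurableSet.of_discrete
  have hsum : P.real {ω | u j ω ∈ Finset.Ico 1 j} = 1 := by
    have e : {ω | u j ω ∈ Finset.Ico 1 j} = ⋃ i ∈ Finset.Ico 1 j, {ω | u j ω = i} := by
      ext ω; simp
    rw [e, measureReal_biUnion_finset]
    · rw [Finset.sum_congr rfl fun i hi =>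
        h.law_u j hj i (Finset.mem_Ico.1 hi).1 (Finset.mem_Ico.1 hi).2]
      have : ((j : ℝ) - 1) ≠ 0 := by
        have : (2 : ℝ) ≤ j := by exact_mod_cast hj
        linarith
      rw [Finset.sum_const, Nat.card_Ico, nsmul_eq_mul, Nat.cast_sub (by omega), Nat.cast_one]
      field_simp
    · intro a _ b _ hab
      refine Set.disjoint_left.2 fun ω h1 h2 => hab ?_
      exact (h1 : u j ω = a).symm.trans h2
    · exact fun i _ => h.measurable_u j hj (MeasurableSet.singleton i)
  refine (mem_ae_iff_prob_eq_one hm).2 ?_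
  rw [← ofReal_measureReal (measure_ne_top _ _), hsum, ENNReal.ofReal_one]


omit [IsProbabilityMeasure P] in
/-- The walk is the word in the `stepValue`s, provided that all choices are in range. -/
lemma walk_eq_wordProd {n : ℕ} {ω : Ω} (hω : ∀ j, 2 ≤ j → u j ω ∈ Finset.Ico 1 j) :
    S n ω = wordProd (stepValue (extendData fun j : Set.Ici 2 => (ξ j ω, u j ω, T j ω))
      fun k => g (k + 1) ω) n := by
  set θ := extendData fun j : Set.Ici 2 => (ξ j ω, u j ω, T j ω) with hθ
  have hX (k : ℕ) : X (k + 1) ω = stepValue θ (fun k => g (k + 1) ω) k := by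
    induction k using Nat.strong_induction_on with
    | _ k ih =>
    rcases Nat.eq_zero_or_pos k with rfl | hk
    · rw [stepValue_of_fresh (by simp [hθ, extendData]), zero_add, h.step_one]
    · have h2 : 2 ≤ k + 1 := by omega
      have e : θ k = (ξ (k + 1) ω, u (k + 1) ω, T (k + 1) ω) := by
        simp [hθ, extendData, h2]
      have hu := Finset.mem_Ico.1 (hω (k + 1) h2)
      rw [stepValue_eq_ite, h.step (k + 1) h2, e]
      have h3 : 1 ≤ u (k + 1) ω ∧ u (k + 1) ω ≤ k := ⟨hu.1, by omega⟩
      simp only [h3, and_self, if_true]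
      rw [← ih (u (k + 1) ω - 1) (by omega), Nat.sub_add_cancel hu.1]
  induction n with
  | zero => exact h.walk_zero ω
  | succ n ihn => rw [h.walk_succ, ihn, hX, wordProd]

lemma ae_walk_eq_wordProd : ∀ᵐ ω ∂P, ∀ n,
    S n ω = wordProd (stepValue (extendData fun j : Set.Ici 2 => (ξ j ω, u j ω, T j ω))
      fun k => g (k + 1) ω) n := by
  have : ∀ᵐ ω ∂P, ∀ j, 2 ≤ j → u j ω ∈ Finset.Ico 1 j := by
    rw [ae_all_iff]
    intro j
    by_cases hj : 2 ≤ j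
    · filter_upwards [h.ae_mem_Ico j hj] with ω hω _ using hω
    · exact .of_forall fun ω h => absurd h hj
  filter_upwards [this] with ω hω n using h.walk_eq_wordProd hω

open Classical in
lemma measureReal_count_lt_le (hα0 : 0 ≤ α) (hα1 : α ≤ 1) {d m : ℕ} (hd : 0 < d)
    (hdm : 4 * m ≤ d) (K : ℕ) :
    P.real {ω | Nat.count (IsUnrepeated (extendData fun j : Set.Ici 2 => (ξ j ω, u j ω, T j ω))
      (d + m)) (d + m) < K} ≤ Real.exp (K - (1 - α) * m / 4) := by
  have h2 (i : Fin m) : 2 ≤ d + i + 1 := by omega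
  let e : Fin m → Set.Ici 2 := fun i => ⟨d + i + 1, h2 i⟩
  have he : Function.Injective e := fun i j hij => by
    have : d + (i : ℕ) + 1 = d + j + 1 := congrArg Subtype.val hij
    ext; omega
  have hd' : (0 : ℝ) < d := by exact_mod_cast hd
  have hmain := measureReal_freshSet_lt_le (P := P) (fun i => h.measurable_ξ _ (h2 i))
    (fun i => h.measurable_u _ (h2 i)) (h.indep_ξ.precomp he) (h.indep_u.precomp he)
    (h.indep_ξ_u.comp (φ := fun b i => b (e i)) (ψ := fun b i => b (e i))
      (measurable_pi_lambda _ fun i => measurable_pi_apply _)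
      (measurable_pi_lambda _ fun i => measurable_pi_apply _)) hα0 hα1
    (fun i => h.law_ξ _ (h2 i)) (a := d + 1) (δ := 1 / d) (fun i j hji => by
      rw [h.law_u _ (h2 i) (d + 1 + j) (by omega) (by have := Fin.lt_def.1 hji; omega)]
      push_cast
      gcongr
      linarith [(Nat.cast_nonneg i : (0 : ℝ) ≤ (i : ℕ))]) (by positivity)
    (by
      rw [mul_one_div, div_le_iff₀ hd']
      have : (4 * m : ℝ) ≤ d := by exact_mod_cast hdm
      linarith) K
  refine (measureReal_mono ?_ (measure_ne_top _ _)).trans hmain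
  intro ω hω
  simp only [Set.mem_ofPred_eq] at hω ⊢
  have := card_freshSet_le (extendData fun j : Set.Ici 2 => (ξ j ω, u j ω, T j ω)) d m
  have e1 (i : Fin m) : extendData (fun j : Set.Ici 2 => (ξ j ω, u j ω, T j ω)) (d + i) =
      (ξ (d + i + 1) ω, u (d + i + 1) ω, T (d + i + 1) ω) := by
    simp [extendData, h2]
  simp only [e1] at this
  omega

open Classical in
lemma measure_count_and_walk_le [Countable G] [Infinite G] [DiscreteMeasurableSpace G]
    [IsProbabilityMeasure μ] (hμ : IsIrreducibleStep μ) {γ : ℝ} (hγ0 : 0 ≤ γ)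
    (hγ : γ ≤ μ.real {1}) {η : ℝ} (hη : 0 < η) {K n : ℕ}
    (hK : ∫ r in (4 : ℝ)..(4 / η), 1 / (r * isoperimetricProfile μ r ^ 2) < γ / 32 * K) (x : G) :
    P {ω | 2 * K ≤ Nat.count (IsUnrepeated (extendData fun j : Set.Ici 2 =>
        (ξ j ω, u j ω, T j ω)) n) n ∧
      wordProd (stepValue (extendData fun j : Set.Ici 2 => (ξ j ω, u j ω, T j ω))
        fun k => g (k + 1) ω) n = x} ≤ ENNReal.ofReal η := by
  have hg (k : ℕ) : Measurable (g (k + 1)) := h.measurable_g _ (by omega)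
  let V : Ω → Set.Ici 2 → Bool × ℕ × (G → G) := fun ω j => (ξ j ω, u j ω, T j ω)
  let W : Ω → Set.Ici 1 → G := fun ω j => g j ω
  let W' : (Set.Ici 1 → G) → ℕ → G := fun w k => w ⟨k + 1, by simp⟩
  have hV : Measurable V := measurable_pi_lambda _ fun j =>
    (h.measurable_ξ j j.2).prodMk ((h.measurable_u j j.2).prodMk (h.measurable_T j j.2))
  have hW : Measurable W := measurable_pi_lambda _ fun j => h.measurable_g j j.2
  have hF : Measurable fun vw : (Set.Ici 2 → Bool × ℕ × (G → G)) × (Set.Ici 1 → G) =>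
      wordProd (stepValue (extendData vw.1) (W' vw.2)) n :=
    measurable_wordProd (fun k => measurable_stepValue
      (θ := fun vw : (Set.Ici 2 → Bool × ℕ × (G → G)) × (Set.Ici 1 → G) => extendData vw.1)
      (g := fun vw => W' vw.2)
      (fun k => (measurable_extendData k).comp measurable_fst)
      (fun k => (measurable_pi_apply _).comp measurable_snd) k) n
  exact measure_le_of_indepFun hV hW h.indep_fresh.symm
    (B := {vw | wordProd (stepValue (extendData vw.1) (W' vw.2)) n = x})
    (hF (MeasurableSet.singleton x))
    (E := {v | 2 * K ≤ Nat.count (IsUnrepeated (extendData v) n) n})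
    (measurable_count_isUnrepeated measurable_extendData n n
      (MeasurableSet.of_discrete (s := {c | 2 * K ≤ c})))
    fun v hv => measure_wordProd_stepValue_le hμ hγ0 hγ hg
      (h.indep_g.precomp (g := fun k : ℕ => (⟨k + 1, by simp⟩ : Set.Ici 1))
        fun i j hij => by simpa using hij)
      (fun k => h.law_g _ (by omega)) (extendData v) hη hK hv x

end IsGeneralizedSRRW

end Walk

theorem theorem1p4 (μ₀ : ℝ) (hμ₀ : 0 < μ₀) (hμ₀' : μ₀ ≤ 1 / 2) :
    ∃ C : ℝ, 0 < C ∧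
      ∀ (G : Type v) [Group G] [Countable G] [Infinite G]
        [MeasurableSpace G] [DiscreteMeasurableSpace G]
        (Ω : Type w) [MeasurableSpace Ω] (P : Measure Ω) [IsProbabilityMeasure P]
        (μ : Measure G) [IsProbabilityMeasure μ] (α : ℝ)
        (ξ : ℕ → Ω → Bool) (u : ℕ → Ω → ℕ) (T : ℕ → Ω → G → G) (g X S : ℕ → Ω → G),
        0 ≤ α → α < 1 →
        IsGeneralizedSRRW P α μ ξ u T g X S →
        IsIrreducibleStep μ →
        μ₀ ≤ μ.real {1} →
        ∀ ε : ℝ, 0 < ε → ε < 1 →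
        ∀ n : ℕ,
          C / (1 - α) * (∫ r in (4 : ℝ)..(8 / ε), 1 / (r * isoperimetricProfile μ r ^ 2)) ≤ n →
          ∀ x : G, P.real {ω | S n ω = x} ≤ ε := by
  classical
  -- `A` is the number of `μ`-letters needed per unit of the integral, from the increment `μ₀ / 32`.
  -- The factor `40` comes from the window `m ≥ n / 10` and the exponent `(1 - α) * m / 4`.
  set A : ℝ := 32 / μ₀ with hA
  have hA0 : 0 < A := by positivity
  refine ⟨40 * (2 * A + 5), by positivity, ?_⟩
  intro G _ _ _ _ _ Ω _ P _ μ _ α ξ u T g X S hα0 hα1 h hμ hlazy ε hε0 hε1 n hn x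
  set J := ∫ r in (4 : ℝ)..(8 / ε), 1 / (r * isoperimetricProfile μ r ^ 2) with hJ
  have hα : 0 < 1 - α := by linarith
  have hJlog : Real.log (2 / ε) ≤ J := by
    have h8 : 4 ≤ 8 / ε := by rw [le_div_iff₀ hε0]; linarith
    have h1 := log_div_le_integral_profile μ hμ (by norm_num : (1 : ℝ) ≤ 4) h8
    refine le_trans ?_ h1
    have e : 8 / ε / 4 = 2 / ε := by field_simp; norm_num
    have p0 := isoperimetricProfile_pos μ hμ (by norm_num : (1 : ℝ) ≤ 4)
    have p1 := isoperimetricProfile_le_one μ (by norm_num : (1 : ℝ) ≤ 4)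
    rw [e, le_div_iff₀ (by positivity)]
    refine mul_le_of_le_one_right (Real.log_nonneg ?_) (pow_le_one₀ p0.le p1)
    rw [le_div_iff₀ hε0]; linarith
  have hJhalf : 1 / 2 ≤ J := by
    have : Real.log 2 ≤ Real.log (2 / ε) := Real.log_le_log (by norm_num) (by
      rw [le_div_iff₀ hε0]; linarith)
    linarith [Real.log_two_gt_d9]
  have hnJ : 40 * (2 * A + 5) * J ≤ (1 - α) * n := by
    rw [div_mul_eq_mul_div, div_le_iff₀ hα] at hn
    linarith
  have hn100 : 100 ≤ (n : ℝ) := by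
    have h1 : (1 - α) * n ≤ n := mul_le_of_le_one_left (Nat.cast_nonneg n) (by linarith)
    nlinarith [mul_nonneg hA0.le (by linarith : 0 ≤ J)]
  have hn100' : 100 ≤ n := by exact_mod_cast hn100
  set K := ⌊A * J⌋₊ + 1 with hK
  have hKlt : A * J < K := by rw [hK]; push_cast; exact Nat.lt_floor_add_one _
  have hKle : (K : ℝ) ≤ A * J + 1 := by
    rw [hK]; push_cast
    have := Nat.floor_le (by positivity : 0 ≤ A * J)
    linarith
  -- Only the last `m = n / 5` steps are searched for uncopied fresh ones: they are at most a
  -- quarter of the `d` steps before them, so that they rarely copy each other.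
  obtain ⟨d, m, rfl, hm4, hm10⟩ : ∃ d m, n = d + m ∧ 4 * m ≤ d ∧ n ≤ 10 * m :=
    ⟨n - n / 5, n / 5, by omega, by omega, by omega⟩
  have hbad := h.measureReal_count_lt_le hα0 hα1.le (by omega : 0 < d) hm4 (2 * K)
  have hgood := h.measure_count_and_walk_le (n := d + m) hμ hμ₀.le hlazy (half_pos hε0) (K := K) (by
    have e : 4 / (ε / 2) = 8 / ε := by field_simp; norm_num
    rw [e, ← hJ]
    have := mul_lt_mul_of_pos_left hKlt (by positivity : 0 < μ₀ / 32)
    have e2 : μ₀ / 32 * (A * J) = J := by rw [hA]; field_simp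
    rwa [e2] at this) x
  have hbad' : Real.exp ((2 * K : ℕ) - (1 - α) * m / 4) ≤ ε / 2 := by
    have h1 : ((2 * K : ℕ) : ℝ) - (1 - α) * m / 4 ≤ -Real.log (2 / ε) := by
      have h10 : ((d + m : ℕ) : ℝ) ≤ 10 * m := by exact_mod_cast hm10
      have h2 := mul_le_mul_of_nonneg_left h10 hα.le
      push_cast at h2 hnJ ⊢
      nlinarith
    refine (Real.exp_le_exp.2 h1).trans (le_of_eq ?_)
    rw [Real.exp_neg, Real.exp_log (by positivity), inv_div]
  set θ : Ω → ℕ → Bool × ℕ × (G → G) :=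
    fun ω => extendData fun j : Set.Ici 2 => (ξ j ω, u j ω, T j ω) with hθ
  set E₁ := {ω | Nat.count (IsUnrepeated (θ ω) (d + m)) (d + m) < 2 * K}
  set E₂ := {ω | 2 * K ≤ Nat.count (IsUnrepeated (θ ω) (d + m)) (d + m) ∧
    wordProd (stepValue (θ ω) fun k => g (k + 1) ω) (d + m) = x}
  have hgood' : P.real E₂ ≤ ε / 2 :=
    ENNReal.toReal_le_of_le_ofReal (by positivity) hgood
  have hsub : {ω | S (d + m) ω = x} ≤ᵐ[P] (E₁ ∪ E₂ : Set Ω) := by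
    filter_upwards [h.ae_walk_eq_wordProd] with ω hω hS
    rcases Nat.lt_or_ge (Nat.count (IsUnrepeated (θ ω) (d + m)) (d + m)) (2 * K) with h1 | h1
    · exact Or.inl h1
    · exact Or.inr ⟨h1, (hω _).symm.trans hS⟩
  calc P.real {ω | S (d + m) ω = x} ≤ P.real (E₁ ∪ E₂) :=
        ENNReal.toReal_mono (measure_ne_top _ _) (measure_mono_ae hsub)
    _ ≤ P.real E₁ + P.real E₂ := measureReal_union_le _ _
    _ ≤ ε := by linarith
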